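/- Let $n,d\ge 1$, $\mu,\sigma,\lambda>0$, $p\in(\tfrac12,1]$, put $\lambda_p:=(2p-1)\lambda$ and assume $\lambda_p<2\mu$. Let $$\varphi(x)=\Big(\frac{\mu}{\pi\sigma^2}\Big)^{d/2}e^{-\frac{\mu}{\sigma^2}\|x\|^2},\qquad T_sg(x)=\int_{\mathbb R^d}g\big(e^{-\mu s}x+\sqrt{1-e^{-2\mu s}}\,y\big)\varphi(y)\,dy$$ be the invariant density and the semigroup of the Ornstein–Uhlenbeck process on $\mathbb R^d$ with generator $\tfrac12\sigma^2\Delta-\mu x\cdot\nabla$. On $\mathbb R_+\times\mathbb R^d$ consider the measures $$\mu_1(dt\,dx)=\big(\delta_0(dt)+2\lambda p\,e^{\lambda_pt}dt\big)\varphi(x)\,dx,\qquad \mu_2(dt\,dx)=2\lambda p\,e^{\lambda_pt}\varphi(x)\,dt\,dx .$$ Let $Z$ be a Gaussian stochastic measure with intensity $\mu_1$ on a probability space $(\Omega,\mathcal F,\mathbb P)$, that is, a jointly Gaussian centred family $(Z(A))_{\mu_1(A)<\infty}$ with $\mathbb E Z(A)Z(B)=\mu_1(A\cap B)$, and let $I_k$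 be the $k$-fold multiple stochastic (Wiener–Itô) integral with respect to $Z$, defined on $L^2(\mu_1^{\otimes k})$. Let $\mathcal P(\mathbb R^{nd})$ be the space of continuous $f:(\mathbb R^d)^n=\mathbb R^{nd}\to\mathbb R$ such that $|f(x)|/\|x\|^m\to0$ as $\|x\|\to\infty$ for some $m\in\mathbb N$, with the norm $\|f\|_{\mathcal P}=\sup_x e^{-\sum_{i=1}^{nd}|x_i|}|f(x)|$. Such an $f$ is a canonical kernel if $\int_{\mathbb R^d} f(x_1,\dots,x_n)\varphi(x_k)\,dx_k=0$ for every $k$ and all values of the other variables; let $\mathrm{Can}\subset\mathcal P(\mathbb R^{nd})$ be the set of canonical kernels with the norm $\|\cdot\|_{\mathcal P}$. Put $H(f)(s_1,x_1,\dots,s_n,x_n)=\big(\bigotimes_{i=1}^nT_{s_i}\big)f(x_1,\dots,x_n)$. A Feynman diagram $\gamma$ labeled by $\{1,\dots,n\}$ is a graph on $\{1,\dots,n\}$ whose edge set $E_\gamma$ consists of edges without common endpoints; $A_\gamma$ is the set of its unpaired vertices. Put $$L(f,\gamma)=I_{|A_\gamma|}\Big(\Big(\prod_{(j,k)\in E_\gamma}\int\mu_2(dz_{j,k})\Big)H(f)(u_1,\dots,u_n)\Big),\qquad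 L_1(f)=\sum_\gamma L(f,\gamma),$$ where $u_j=u_k=z_{j,k}$ if $(j,k)\in E_\gamma$, $u_i=z_i$ if $i\in A_\gamma$, and the sum is over all Feynman diagrams labeled by $\{1,\dots,n\}$. Then for every $f\in\mathrm{Can}$ and every $\gamma$ the variable $L(f,\gamma)$ is well defined (the $\mu_2$-integrals converge absolutely, and the resulting function of $(z_i)_{i\in A_\gamma}$ belongs to $L^2(\mu_1^{\otimes|A_\gamma|})$, so that its multiple stochastic integral exists and is almost surely unique), and $\mathbb E\,L_1(f)^2<\infty$. Moreover, the map $L_1:\mathrm{Can}\to L^2(\Omega,\mathcal F,\mathbb P)$ is continuous. -/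

import Mathlib

open MeasureTheory ProbabilityTheory Filter Topology

/-! ### The space of continuous functions of polynomial growth on `ℝ^{nd}` -/

/-- `(ℝ^d)^n`, identified with `ℝ^{nd}`. -/
abbrev Config (n d : ℕ) : Type := Fin n → EuclideanSpace ℝ (Fin d)

/-- The Euclidean norm of `x ∈ (ℝ^d)^n = ℝ^{nd}`. -/
noncomputable def configNorm {n d : ℕ} (x : Config n d) : ℝ := Real.sqrt (∑ i, ‖x i‖ ^ 2)

/-- The weight `n(x) = exp (-∑ |x_{ij}|)` on `ℝ^{nd}`, the sum over all `nd` coordinates. -/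
noncomputable def configWeight {n d : ℕ} (x : Config n d) : ℝ :=
  Real.exp (-∑ i, ∑ j, |x i j|)

/-- `f` is continuous, and `|f x| / ‖x‖ ^ m → 0` as `‖x‖ → ∞`, for some `m`. -/
def IsPolyGrowth {n d : ℕ} (f : Config n d → ℝ) : Prop :=
  Continuous f ∧
    ∃ m : ℕ, Tendsto (fun x => |f x| / configNorm x ^ m) (comap configNorm atTop) (𝓝 0)

lemma coord_le_configNorm {n d : ℕ} (x : Config n d) (i : Fin n) : ‖x i‖ ≤ configNorm x := by
  apply Real.le_sqrt_of_sq_le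
  exact Finset.single_le_sum (f := fun i => ‖x i‖ ^ 2) (fun _ _ => sq_nonneg _)
    (Finset.mem_univ i)

lemma norm_le_configNorm {n d : ℕ} (x : Config n d) : ‖x‖ ≤ configNorm x :=
  (pi_norm_le_iff_of_nonneg (Real.sqrt_nonneg _)).2 (coord_le_configNorm x)

lemma configNorm_le_sum {n d : ℕ} (x : Config n d) : configNorm x ≤ ∑ i, ∑ j, |x i j| := by
  have h1 : ∀ i, ‖x i‖ ≤ ∑ j, |x i j| := by
    intro i
    rw [EuclideanSpace.norm_eq]
    refine Real.sqrt_le_iff.2 ⟨Finset.sum_nonneg fun _ _ => abs_nonneg _, ?_⟩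
    simpa using Finset.sum_sq_le_sq_sum_of_nonneg (s := Finset.univ)
      (f := fun j => |x i j|) (fun _ _ => abs_nonneg _)
  refine le_trans (Real.sqrt_le_iff.2 ⟨Finset.sum_nonneg fun _ _ => norm_nonneg _, ?_⟩)
    (Finset.sum_le_sum fun i _ => h1 i)
  exact Finset.sum_sq_le_sq_sum_of_nonneg (s := Finset.univ) (f := fun i => ‖x i‖)
    (fun _ _ => norm_nonneg _)

lemma configWeight_mul_pow_le {n d : ℕ} (x : Config n d) (m : ℕ) :
    configWeight x * configNorm x ^ m ≤ m.factorial := by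
  have h0 : 0 ≤ configNorm x := Real.sqrt_nonneg _
  have h1 := configNorm_le_sum x
  have hS := h0.trans h1
  have h2 := Real.pow_div_factorial_le_exp _ hS m
  have h3 : (0 : ℝ) < m.factorial := by exact_mod_cast m.factorial_pos
  rw [div_le_iff₀ h3] at h2
  unfold configWeight
  rw [Real.exp_neg, inv_mul_le_iff₀ (Real.exp_pos _)]
  exact (pow_le_pow_left₀ h0 h1 m).trans h2

lemma continuous_configNorm {n d : ℕ} : Continuous (configNorm : Config n d → ℝ) := by
  unfold configNorm; fun_prop

lemma continuous_configWeight {n d : ℕ} : Continuous (configWeight : Config n d → ℝ) := by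
  unfold configWeight; fun_prop

lemma isCompact_configNorm_le {n d : ℕ} (R : ℝ) :
    IsCompact {x : Config n d | configNorm x ≤ R} := by
  refine (isCompact_closedBall (0 : Config n d) R).of_isClosed_subset
    (isClosed_le continuous_configNorm continuous_const) fun x hx => ?_
  simpa using (norm_le_configNorm x).trans hx

/-- The defining supremum of the norm on the space of functions of polynomial growth is finite. -/
lemma IsPolyGrowth.bddAbove {n d : ℕ} {f : Config n d → ℝ} (hf : IsPolyGrowth f) :
    BddAbove (Set.range fun x => |configWeight x * f x|) := by
  obtain ⟨hc, m, hm⟩ := hf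
  have h1 := hm.eventually (gt_mem_nhds (zero_lt_one))
  rw [eventually_comap] at h1
  obtain ⟨R, hR⟩ := eventually_atTop.1 h1
  obtain ⟨C, hC⟩ :=
    (isCompact_configNorm_le (n := n) (d := d) (max R 1)).exists_bound_of_continuousOn
    (continuous_configWeight.mul hc).continuousOn
  refine ⟨max C m.factorial, ?_⟩
  rintro _ ⟨x, rfl⟩
  by_cases hx : configNorm x ≤ max R 1
  · exact le_max_of_le_left (by simpa using hC x hx)
  · push Not at hx
    have hx1 : 0 < configNorm x := lt_of_lt_of_le one_pos ((le_max_right _ _).trans hx.le)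
    have h2 := hR _ ((le_max_left _ _).trans hx.le) x rfl
    rw [div_lt_one (pow_pos hx1 m)] at h2
    have hw : 0 < configWeight x := Real.exp_pos _
    refine le_max_of_le_right ?_
    change |configWeight x * f x| ≤ _
    rw [abs_mul, abs_of_pos hw]
    exact (mul_le_mul_of_nonneg_left h2.le hw.le).trans (configWeight_mul_pow_le x m)

lemma IsPolyGrowth.exists_mono {n d : ℕ} {f : Config n d → ℝ} {m m' : ℕ} (h : m ≤ m')
    (hm : Tendsto (fun x => |f x| / configNorm x ^ m) (comap configNorm atTop) (𝓝 0)) :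
    Tendsto (fun x => |f x| / configNorm x ^ m') (comap configNorm atTop) (𝓝 0) := by
  refine squeeze_zero' (Eventually.of_forall fun x => ?_) ?_ hm
  · exact div_nonneg (abs_nonneg _) (pow_nonneg (Real.sqrt_nonneg _) _)
  · have h1 : ∀ᶠ x : Config n d in comap configNorm atTop, 1 ≤ configNorm x :=
      tendsto_comap.eventually (eventually_ge_atTop 1)
    filter_upwards [h1] with x hx
    exact div_le_div_of_nonneg_left (abs_nonneg _) (by positivity) (pow_le_pow_right₀ hx h)

/-- The continuous functions of polynomial growth, as a linear space. -/
def polyGrowthSubmodule (n d : ℕ) : Submodule ℝ (Config n d → ℝ) where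
  carrier := {f | IsPolyGrowth f}
  zero_mem' := ⟨continuous_const, 0, by simpa using tendsto_const_nhds⟩
  add_mem' := by
    rintro f g ⟨hf, m, hm⟩ ⟨hg, k, hk⟩
    refine ⟨hf.add hg, max m k, ?_⟩
    have h := (IsPolyGrowth.exists_mono (le_max_left m k) hm).add
      (IsPolyGrowth.exists_mono (le_max_right m k) hk)
    rw [add_zero] at h
    refine squeeze_zero (fun x => div_nonneg (abs_nonneg _) (pow_nonneg (Real.sqrt_nonneg _) _))
      (fun x => ?_) h
    rw [← add_div]
    exact div_le_div_of_nonneg_right (abs_add_le _ _) (pow_nonneg (Real.sqrt_nonneg _) _)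
  smul_mem' := by
    rintro c f ⟨hf, m, hm⟩
    refine ⟨hf.const_smul c, m, ?_⟩
    have h := hm.const_mul |c|
    rw [mul_zero] at h
    refine h.congr fun x => ?_
    simp [abs_mul, mul_div_assoc]

/-- The space `𝒫(ℝ^{nd})`.  It is a type of its own, so that its only topology is the one of the
norm below (and not that of pointwise convergence). -/
def PSpace (n d : ℕ) : Type := polyGrowthSubmodule n d

noncomputable instance (n d : ℕ) : AddCommGroup (PSpace n d) :=
  inferInstanceAs (AddCommGroup (polyGrowthSubmodule n d))

noncomputable instance (n d : ℕ) : Module ℝ (PSpace n d) :=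
  inferInstanceAs (Module ℝ (polyGrowthSubmodule n d))

/-- The function underlying an element of `𝒫(ℝ^{nd})`. -/
def PSpace.toFun {n d : ℕ} (f : PSpace n d) : Config n d → ℝ := f.1

/-- The norm `‖f‖_𝒫 = sup_x |n(x) f(x)|`. -/
noncomputable instance (n d : ℕ) : Norm (PSpace n d) :=
  ⟨fun f => ⨆ x, |configWeight x * f.toFun x|⟩

noncomputable instance (n d : ℕ) : NormedAddCommGroup (PSpace n d) :=
  AddGroupNorm.toNormedAddCommGroup
    { toFun := fun f => ‖f‖
      map_zero' := by
        change (⨆ x, |configWeight x * (0 : ℝ)|) = 0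
        simp
      add_le' := by
        intro f g
        refine ciSup_le fun x => ?_
        have hf := le_ciSup (IsPolyGrowth.bddAbove f.2) x
        have hg := le_ciSup (IsPolyGrowth.bddAbove g.2) x
        change |configWeight x * (f.1 x + g.1 x)| ≤ _
        rw [mul_add]
        exact (abs_add_le _ _).trans (add_le_add hf hg)
      neg' := by
        intro f
        change (⨆ x, |configWeight x * (-(f.1 x))|) = ⨆ x, |configWeight x * f.1 x|
        simp
      eq_zero_of_map_eq_zero' := by
        intro f hf
        refine Subtype.ext (funext fun x => ?_)
        have h : |configWeight x * f.1 x| ≤ 0 :=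
          (le_ciSup (IsPolyGrowth.bddAbove f.2) x).trans_eq hf
        have h2 := abs_nonpos_iff.1 h
        exact (mul_eq_zero.1 h2).resolve_left (Real.exp_pos _).ne' }

/-! ### The Ornstein--Uhlenbeck process -/

/-- The invariant law of the Ornstein--Uhlenbeck process with generator
`(σ² / 2) Δ - μ x ∘ ∇` on `ℝ^d`: it has the density
`φ(x) = (μ / (π σ²))^{d/2} exp (-(μ / σ²) ‖x‖²)`. -/
noncomputable def ouInvariant (d : ℕ) (μ σ : ℝ) : Measure (EuclideanSpace ℝ (Fin d)) :=
  volume.withDensity fun x => ENNReal.ofReal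
    ((μ / (Real.pi * σ ^ 2)) ^ ((d : ℝ) / 2) * Real.exp (-(μ / σ ^ 2) * ‖x‖ ^ 2))

/-- `f` is a canonical (completely degenerate) kernel: its integral in each single variable against
the invariant law vanishes, for all values of the other variables. -/
def IsCanonical {n d : ℕ} (μ σ : ℝ) (f : Config n d → ℝ) : Prop :=
  ∀ (k : Fin n) (x : Config n d), ∫ y, f (Function.update x k y) ∂(ouInvariant d μ σ) = 0

/-- The set of canonical kernels in `𝒫(ℝ^{nd})`; as a subtype it carries the norm metric. -/
def Can (n d : ℕ) (μ σ : ℝ) : Set (PSpace n d) := {f | IsCanonical μ σ f.toFun}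

/-- A point `z = (s, x)` of `ℝ^{d+1} = ℝ × ℝ^d`. -/
abbrev TimeSpace (d : ℕ) : Type := ℝ × EuclideanSpace ℝ (Fin d)

/-- `H(f)(s₁, x₁, …, sₙ, xₙ) = (⨂ T_{sᵢ}) f (x₁, …, xₙ)`, where `T` is the Ornstein--Uhlenbeck
semigroup, `T_s g (x) = ∫ g (e^{-μ s} x + √(1 - e^{-2 μ s}) y) φ(y) dy`.
Only nonnegative times matter. -/
noncomputable def ouTensor {n d : ℕ} (μ σ : ℝ) (f : Config n d → ℝ)
    (z : Fin n → TimeSpace d) : ℝ :=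
  ∫ y : Config n d,
    f (fun i => Real.exp (-μ * (z i).1) • (z i).2
      + Real.sqrt (1 - Real.exp (-2 * μ * (z i).1)) • y i)
    ∂(Measure.pi fun _ => ouInvariant d μ σ)

/-- The growth rate `λ_p = (2p - 1) λ`. -/
noncomputable def growthRate (lam p : ℝ) : ℝ := (2 * p - 1) * lam

/-- The measure `2 λ p e^{λ_p t} dt` on `ℝ₊`. -/
noncomputable def branchTime (lam p : ℝ) : Measure ℝ :=
  (volume.restrict (Set.Ici 0)).withDensity fun t =>
    ENNReal.ofReal (2 * lam * p * Real.exp (growthRate lam p * t))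

/-- `μ₁(dt dx) = (δ₀(dt) + 2 λ p e^{λ_p t} dt) φ(x) dx` on `ℝ₊ × ℝ^d`. -/
noncomputable def intensityOne (d : ℕ) (μ σ lam p : ℝ) : Measure (TimeSpace d) :=
  (Measure.dirac 0 + branchTime lam p).prod (ouInvariant d μ σ)

/-- `μ₂(dt dx) = 2 λ p e^{λ_p t} φ(x) dt dx` on `ℝ₊ × ℝ^d`. -/
noncomputable def intensityTwo (d : ℕ) (μ σ lam p : ℝ) : Measure (TimeSpace d) :=
  (branchTime lam p).prod (ouInvariant d μ σ)

/-! ### Gaussian stochastic measures and multiple stochastic integrals -/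

section StochasticIntegral

variable {M Ω : Type*} [MeasurableSpace M] [MeasurableSpace Ω]

/-- `Z` is a Gaussian stochastic measure with intensity `ν`: the variables `Z A`, for `A`
measurable with `ν A < ∞`, are jointly Gaussian and centred, and `𝔼[Z A * Z B] = ν (A ∩ B)`.
(The values of `Z` on other sets play no role.) -/
structure IsGaussianStochasticMeasure (ν : Measure M) (P : Measure Ω) (Z : Set M → Ω → ℝ) :
    Prop where
  gaussian : IsGaussianProcess (fun A : {A : Set M // MeasurableSet A ∧ ν A < ⊤} => Z A) P
  centred : ∀ A, MeasurableSet A → ν A < ⊤ → ∫ ω, Z A ω ∂P = 0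
  covariance : ∀ A B, MeasurableSet A → ν A < ⊤ → MeasurableSet B → ν B < ⊤ →
    ∫ ω, Z A ω * Z B ω ∂P = ν.real (A ∩ B)

/-- An elementary integrand: a finite linear combination `∑ₖ cₖ 1_{∏ᵢ A_{k,i}}` of indicators of
rectangles with pairwise disjoint measurable sides of finite measure. -/
structure ElementaryIntegrand (ν : Measure M) (ι : Type*) where
  size : ℕ
  coeff : Fin size → ℝ
  side : Fin size → ι → Set M
  measurable : ∀ k i, MeasurableSet (side k i)
  finite : ∀ k i, ν (side k i) < ⊤
  disjoint : ∀ k i j, i ≠ j → Disjoint (side k i) (side k j)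

/-- The function `∑ₖ cₖ ∏ᵢ 1_{A_{k,i}}(zᵢ)`. -/
noncomputable def ElementaryIntegrand.toFun {ν : Measure M} {ι : Type*} [Fintype ι]
    (e : ElementaryIntegrand ν ι) (z : ι → M) : ℝ :=
  ∑ k, e.coeff k * ∏ i, (e.side k i).indicator (fun _ => (1 : ℝ)) (z i)

/-- The multiple stochastic integral `∑ₖ cₖ ∏ᵢ Z(A_{k,i})` of an elementary integrand. -/
noncomputable def ElementaryIntegrand.integral {ν : Measure M} {ι : Type*} [Fintype ι]
    (e : ElementaryIntegrand ν ι) (Z : Set M → Ω → ℝ) (ω : Ω) : ℝ :=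
  ∑ k, e.coeff k * ∏ i, Z (e.side k i) ω

/-- `X` is the multiple stochastic integral of `g ∈ L²(ν^ι)` with respect to a Gaussian stochastic
measure `Z` with atomless intensity `ν`: the `L²`-limit of the integrals of elementary integrands
that converge to `g` in `L²(ν^ι)`. For empty `ι` this is the constant value of `g`. -/
def HasMultipleIntegral (ν : Measure M) (P : Measure Ω) (Z : Set M → Ω → ℝ)
    {ι : Type*} [Fintype ι] (g : (ι → M) → ℝ) (X : Ω → ℝ) : Prop :=
  MemLp g 2 (Measure.pi fun _ : ι => ν) ∧ MemLp X 2 P ∧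
    ∃ e : ℕ → ElementaryIntegrand ν ι,
      Tendsto (fun k => eLpNorm (fun z => (e k).toFun z - g z) 2 (Measure.pi fun _ : ι => ν))
        atTop (𝓝 0) ∧
      Tendsto (fun k => eLpNorm (fun ω => (e k).integral Z ω - X ω) 2 P) atTop (𝓝 0)

open Classical in
/-- The multiple stochastic integral `I_{|ι|}(g)` (a version of it; `0` where it does not exist). -/
noncomputable def multipleIntegral (ν : Measure M) (P : Measure Ω) (Z : Set M → Ω → ℝ)
    {ι : Type*} [Fintype ι] (g : (ι → M) → ℝ) : Ω → ℝ :=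
  if h : ∃ X, HasMultipleIntegral ν P Z g X then h.choose else 0

end StochasticIntegral

/-! ### Feynman diagrams and the limit variable -/

/-- A Feynman diagram labeled by `Fin n`: a graph no two edges of which share an endpoint. -/
structure FeynmanDiagram (n : ℕ) where
  graph : SimpleGraph (Fin n)
  matching : ∀ i j k, graph.Adj i j → graph.Adj i k → j = k

namespace FeynmanDiagram

variable {n : ℕ}

/-- The edges `E_γ`. -/
abbrev Edge (γ : FeynmanDiagram n) : Type := {e : Sym2 (Fin n) // e ∈ γ.graph.edgeSet}

/-- The unpaired vertices `A_γ`. -/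
abbrev Unpaired (γ : FeynmanDiagram n) : Type := {i : Fin n // ∀ j, ¬ γ.graph.Adj i j}

noncomputable instance (γ : FeynmanDiagram n) : Fintype γ.Edge := Fintype.ofFinite _

noncomputable instance (γ : FeynmanDiagram n) : Fintype γ.Unpaired := Fintype.ofFinite _

instance : Finite (FeynmanDiagram n) :=
  Finite.of_injective FeynmanDiagram.graph fun γ δ h => by
    cases γ; cases δ; cases h; rfl

noncomputable instance : Fintype (FeynmanDiagram n) := Fintype.ofFinite _

open Classical in
/-- The arguments `u₁, …, uₙ`: `uᵢ` is `z i` for an unpaired vertex `i`, and otherwise the variable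
`w e` of the edge `e` at `i`. -/
noncomputable def arguments {M : Type*} (γ : FeynmanDiagram n) (z : γ.Unpaired → M)
    (w : γ.Edge → M) (i : Fin n) : M :=
  if h : ∃ j, γ.graph.Adj i j then
    w ⟨s(i, h.choose), (SimpleGraph.mem_edgeSet _).2 h.choose_spec⟩
  else z ⟨i, not_exists.1 h⟩

end FeynmanDiagram

section LimitVariable

variable {n d : ℕ} (μ σ lam p : ℝ)

/-- `z ↦ (∏_{e ∈ E_γ} ∫ μ₂(dw_e)) H(f)(u₁, …, uₙ)`, a function of `z : A_γ → ℝ₊ × ℝ^d`. -/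
noncomputable def diagramKernel (f : Config n d → ℝ) (γ : FeynmanDiagram n)
    (z : γ.Unpaired → TimeSpace d) : ℝ :=
  ∫ w, ouTensor μ σ f (γ.arguments z w)
    ∂(Measure.pi fun _ : γ.Edge => intensityTwo d μ σ lam p)

variable {Ω : Type*} [MeasurableSpace Ω] (P : Measure Ω) (Z : Set (TimeSpace d) → Ω → ℝ)

/-- `L(f, γ)`. -/
noncomputable def diagramVariable (f : Config n d → ℝ) (γ : FeynmanDiagram n) : Ω → ℝ :=
  multipleIntegral (intensityOne d μ σ lam p) P Z (diagramKernel μ σ lam p f γ)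

/-- The limit variable `L₁(f) = ∑_γ L(f, γ)`. -/
noncomputable def limitVariable (f : Config n d → ℝ) (ω : Ω) : ℝ :=
  ∑ γ : FeynmanDiagram n, diagramVariable μ σ lam p P Z f γ ω

end LimitVariable

/-!
The proof has an abstract half and an analytic half.

*Multiple stochastic integrals.* Let `Z` be a Gaussian stochastic measure with atomless σ-finite
intensity `ν`. An elementary integrand of order `r` can be refined so that all its sides are atoms
of one finite disjoint family of sets. On such a family `Z` is independent and centred
(`IsGaussianStochasticMeasure.iIndepFun`), so two square-free monomials in its values are orthogonal
unless they agree up to the order of their factors. This gives the bound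
`𝔼 I(e)² ≤ rʳ ∫ e² dν^r` (`ElementaryIntegrand.integral_sq_le`); the sharp constant `r!` is not
needed. Elementary integrands are dense in `L²(ν^r)` (`elementaryApprox_of_memLp`): since `ν` has no
atoms, the diagonals are null sets, and a rectangle is the limit of its parts off finer and finer
blocks around the diagonals. Completeness of `L²` and the bound yield existence, uniqueness and
continuity of the integral (`hasMultipleIntegral_iff`, `HasMultipleIntegral.eLpNorm_sub_le`).

*Decay of the kernels.* A function `g` with `|g(x)| ≤ C exp (∑ⱼ |xⱼ|)` and mean zero under the
invariant law satisfies `|T_s g(x)| ≤ C K e^{-μ s} exp (3 ∑ⱼ |xⱼ|)` for all `s ≥ 0`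
(`abs_integral_comp_affine_le`). For small `s` only the growth has to be controlled. For large `s`
this follows by comparing the Mehler kernel with the constant `1`: its logarithm is of order
`e^{-μ s}` up to polynomial factors, and
`|e^t - 1| ≤ |t| (e^t + 1)`. Integrating out one coordinate at a time gives, for a canonical `f`,
`|H(f)(s, x)| ≤ ‖f‖ ∏ᵢ K e^{-μ sᵢ} exp (3 ∑ⱼ |xᵢⱼ|)` (`abs_ouTensor_le`).

In a Feynman diagram every edge carries two vertices, hence the factor `e^{-2μ s}`, which is
integrable against `e^{λ_p s} ds` because `λ_p < 2μ`; the same comparison makes the factor of an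
unpaired vertex square integrable with respect to `μ₁`. So the integrals over the edges converge
absolutely, and the kernel of each diagram is bounded by `‖f‖` times a fixed function in `L²`. Since
the kernels are linear in `f`, the map `L₁` is Lipschitz.
-/

/-! ### Gaussian stochastic measures on disjoint sets -/

section GaussianMeasure

variable {M Ω : Type*} [MeasurableSpace M] [MeasurableSpace Ω]
  {ν : Measure M} {P : Measure Ω} {Z : Set M → Ω → ℝ}

namespace IsGaussianStochasticMeasure

lemma hasGaussianLaw (hZ : IsGaussianStochasticMeasure ν P Z) {A : Set M} (hA : MeasurableSet A)
    (hA' : ν A < ⊤) : HasGaussianLaw (Z A) P :=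
  hZ.gaussian.hasGaussianLaw_eval ⟨A, hA, hA'⟩

lemma memLp_prod (hZ : IsGaussianStochasticMeasure ν P Z) {ι : Type*} [Fintype ι]
    [IsProbabilityMeasure P] {A : ι → Set M} (hA : ∀ i, MeasurableSet (A i))
    (hA' : ∀ i, ν (A i) < ⊤) : MemLp (fun ω => ∏ i, Z (A i) ω) 2 P := by
  -- By Hölder, `r` factors in `L^N` have a product in `L^{N/r}`; the choice `N = 2 (r + 1)` also
  -- covers `r = 0`.
  set N : ENNReal := 2 * (Fintype.card ι + 1) with hN
  have hN' : N ≠ ⊤ := by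
    rw [hN]; exact ENNReal.mul_ne_top (by simp) (by simp)
  refine (MemLp.prod' (s := Finset.univ) (p := fun _ : ι => N)
    fun i _ => (hZ.hasGaussianLaw (hA i) (hA' i)).memLp hN').mono_exponent ?_
  simp only [Finset.sum_const, Finset.card_univ, nsmul_eq_mul]
  rw [ENNReal.le_inv_iff_le_inv, hN,
    ENNReal.mul_inv (Or.inl (by simp)) (Or.inl (by simp)), mul_left_comm]
  refine mul_le_of_le_one_right' ?_
  rw [← div_eq_mul_inv]
  exact ENNReal.div_le_of_le_mul (by simp)

/-- A Gaussian stochastic measure is almost surely finitely additive: the difference of the two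
sides has vanishing second moment. -/
lemma ae_eq_sum (hZ : IsGaussianStochasticMeasure ν P Z)
    {τ : Type*} (s : Finset τ) {C : τ → Set M} (hC : ∀ t, MeasurableSet (C t))
    (hC' : ∀ t, ν (C t) < ⊤) (hd : Pairwise fun t u => Disjoint (C t) (C u))
    {A : Set M} (hA : MeasurableSet A) (hAC : A = ⋃ t ∈ s, C t) :
    Z A =ᵐ[P] fun ω => ∑ t ∈ s, Z (C t) ω := by
  have hA' : ν A < ⊤ := by
    rw [hAC]; exact (measure_biUnion_finset_le _ _).trans_lt (ENNReal.sum_lt_top.2 fun t _ => hC' t)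
  have hν : ν.real A = ∑ t ∈ s, ν.real (C t) := by
    rw [hAC]
    exact measureReal_biUnion_finset (fun t _ u _ h => hd h) (fun t _ => hC t)
      (fun t _ => (hC' t).ne)
  have mZ := (hZ.hasGaussianLaw hA hA').memLp_two
  have mC := fun t => (hZ.hasGaussianLaw (hC t) (hC' t)).memLp_two
  have mS : MemLp (fun ω => ∑ t ∈ s, Z (C t) ω) 2 P := memLp_finsetSum s fun t _ => mC t
  have mD : MemLp (fun ω => Z A ω - ∑ t ∈ s, Z (C t) ω) 2 P := mZ.sub mS
  have mZC : ∀ t, Integrable (fun ω => Z A ω * Z (C t) ω) P := fun t => mZ.integrable_mul (mC t)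
  have mCC : ∀ t u, Integrable (fun ω => Z (C t) ω * Z (C u) ω) P :=
    fun t u => (mC t).integrable_mul (mC u)
  have i1 : ∫ ω, Z A ω * Z A ω ∂P = ν.real A := by
    rw [hZ.covariance A A hA hA' hA hA', Set.inter_self]
  have i2 : ∫ ω, Z A ω * (∑ t ∈ s, Z (C t) ω) ∂P = ν.real A := by
    simp_rw [Finset.mul_sum]
    rw [integral_finsetSum _ fun t _ => mZC t, hν]
    refine Finset.sum_congr rfl fun t ht => ?_
    rw [hZ.covariance A _ hA hA' (hC t) (hC' t), Set.inter_eq_right.2]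
    rw [hAC]; exact Set.subset_biUnion_of_mem (u := fun t => C t) ht
  have i3 : ∫ ω, (∑ t ∈ s, Z (C t) ω) * (∑ t ∈ s, Z (C t) ω) ∂P = ν.real A := by
    simp_rw [Finset.sum_mul_sum]
    rw [integral_finsetSum _ fun t _ => integrable_finsetSum _
      fun u _ => mCC t u, hν]
    refine Finset.sum_congr rfl fun t ht => ?_
    rw [integral_finsetSum _ fun u _ => mCC t u,
      Finset.sum_eq_single_of_mem t ht]
    · rw [hZ.covariance _ _ (hC t) (hC' t) (hC t) (hC' t), Set.inter_self]
    · intro u _ hut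
      rw [hZ.covariance _ _ (hC t) (hC' t) (hC u) (hC' u), (hd hut.symm).inter_eq]
      simp
  have key : ∫ ω, (Z A ω - ∑ t ∈ s, Z (C t) ω) ^ 2 ∂P = 0 := by
    have : ∀ ω, (Z A ω - ∑ t ∈ s, Z (C t) ω) ^ 2 = (Z A ω * Z A ω
        - 2 * (Z A ω * ∑ t ∈ s, Z (C t) ω))
        + (∑ t ∈ s, Z (C t) ω) * (∑ t ∈ s, Z (C t) ω) := fun ω => by ring
    simp_rw [this]
    have e1 : Integrable (fun ω => Z A ω * Z A ω) P := mZ.integrable_mul mZ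
    have e2 : Integrable (fun ω => 2 * (Z A ω * ∑ t ∈ s, Z (C t) ω)) P :=
      (mZ.integrable_mul mS).const_mul 2
    have e3 : Integrable (fun ω => (∑ t ∈ s, Z (C t) ω) * (∑ t ∈ s, Z (C t) ω)) P :=
      mS.integrable_mul mS
    rw [integral_add (f := fun ω => Z A ω * Z A ω - 2 * (Z A ω * ∑ t ∈ s, Z (C t) ω))
      (e1.sub e2) e3, integral_sub e1 e2, integral_const_mul, i1, i2, i3]
    ring
  rw [integral_eq_zero_iff_of_nonneg (fun ω => sq_nonneg _) mD.integrable_sq] at key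
  filter_upwards [key] with ω hω
  exact sub_eq_zero.1 (pow_eq_zero_iff two_ne_zero |>.1 hω)

/-- The values on disjoint sets are independent. -/
lemma iIndepFun (hZ : IsGaussianStochasticMeasure ν P Z) {τ : Type*} [Fintype τ]
    {C : τ → Set M} (hC : ∀ t, MeasurableSet (C t)) (hC' : ∀ t, ν (C t) < ⊤)
    (hd : Pairwise fun t u => Disjoint (C t) (C u)) :
    iIndepFun (fun t => Z (C t)) P := by
  have hG : IsGaussianProcess (fun t => Z (C t)) P :=
    hZ.gaussian.comp_right fun t : τ => ⟨C t, hC t, hC' t⟩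
  have hL : HasGaussianLaw (fun ω t => Z (C t) ω) P :=
    by
    let L : (↥(Finset.univ : Finset τ) → ℝ) →L[ℝ] (τ → ℝ) :=
      ContinuousLinearMap.pi fun t => ContinuousLinearMap.proj ⟨t, Finset.mem_univ t⟩
    exact (hG.hasGaussianLaw Finset.univ).map L
  refine hL.iIndepFun_of_covariance_eq_zero fun t u htu => ?_
  have : IsProbabilityMeasure P := hG.isProbabilityMeasure
  rw [covariance_eq_sub (hZ.hasGaussianLaw (hC t) (hC' t)).memLp_two
    (hZ.hasGaussianLaw (hC u) (hC' u)).memLp_two, hZ.centred _ (hC t) (hC' t), zero_mul, sub_zero]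
  have := hZ.covariance _ _ (hC t) (hC' t) (hC u) (hC' u)
  rw [(hd htu).inter_eq] at this
  simpa using this

open Classical in
/-- Mixed moments of the values on disjoint sets: by independence, a product of two square-free
monomials has nonzero expectation only if the two agree. -/
lemma integral_prod_mul_prod (hZ : IsGaussianStochasticMeasure ν P Z) {τ : Type*} [Fintype τ]
    {C : τ → Set M} (hC : ∀ t, MeasurableSet (C t)) (hC' : ∀ t, ν (C t) < ⊤)
    (hd : Pairwise fun t u => Disjoint (C t) (C u)) (A B : Finset τ) :
    ∫ ω, (∏ t ∈ A, Z (C t) ω) * (∏ t ∈ B, Z (C t) ω) ∂P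
      = if A = B then ∏ t ∈ A, ν.real (C t) else 0 := by
  have : IsProbabilityMeasure P := hZ.gaussian.isProbabilityMeasure
  have hI := hZ.iIndepFun hC hC' hd
  -- Write the product as one factor for each set of the family, to which independence applies.
  let φ : τ → ℝ → ℝ := fun t x => (if t ∈ A then x else 1) * (if t ∈ B then x else 1)
  have h1 : ∀ ω, (∏ t ∈ A, Z (C t) ω) * (∏ t ∈ B, Z (C t) ω) = ∏ t, φ t (Z (C t) ω) := by
    intro ω
    simp only [φ, Finset.prod_mul_distrib, Finset.prod_ite_mem, Finset.univ_inter]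
  have hφ : ∀ t, Measurable (φ t) := by
    intro t
    by_cases hA : t ∈ A <;> by_cases hB : t ∈ B <;> simp only [φ, hA, hB, if_true, if_false] <;>
      fun_prop
  simp_rw [h1]
  have h2 := hI.integral_fun_prod_comp (f := φ)
    (fun t => (hZ.hasGaussianLaw (hC t) (hC' t)).aemeasurable)
    (fun t => (hφ t).aestronglyMeasurable)
  rw [h2]
  have h3 : ∀ t, ∫ ω, φ t (Z (C t) ω) ∂P = if t ∈ A then (if t ∈ B then ν.real (C t) else 0)
      else (if t ∈ B then 0 else 1) := by
    intro t
    by_cases hA : t ∈ A <;> by_cases hB : t ∈ B <;> simp only [φ, hA, hB, if_true, if_false]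
    · rw [hZ.covariance _ _ (hC t) (hC' t) (hC t) (hC' t), Set.inter_self]
    · simpa using hZ.centred _ (hC t) (hC' t)
    · simpa using hZ.centred _ (hC t) (hC' t)
    · simp
  simp_rw [h3]
  split_ifs with hAB
  · subst hAB
    rw [← Finset.prod_subset (Finset.subset_univ A)]
    · exact Finset.prod_congr rfl fun t ht => by simp [ht]
    · intro t _ ht; simp [ht]
  · obtain ⟨t, ht⟩ : ∃ t, ¬ (t ∈ A ↔ t ∈ B) := by
      by_contra! h; exact hAB (Finset.ext h)
    refine Finset.prod_eq_zero (Finset.mem_univ t) ?_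
    by_cases hA : t ∈ A <;> by_cases hB : t ∈ B <;> simp_all

end IsGaussianStochasticMeasure

open Classical in
/-- Distinct rectangles built from a disjoint family are orthogonal. -/
lemma integral_prod_indicator_mul [SigmaFinite ν] {τ ι : Type*} [Fintype ι]
    {C : τ → Set M} (hC : ∀ t, MeasurableSet (C t))
    (hd : Pairwise fun t u => Disjoint (C t) (C u)) (α β : ι → τ) :
    ∫ z, (∏ i, (C (α i)).indicator (fun _ => (1 : ℝ)) (z i))
        * (∏ i, (C (β i)).indicator (fun _ => (1 : ℝ)) (z i)) ∂(Measure.pi fun _ : ι => ν)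
      = if α = β then ∏ i, ν.real (C (α i)) else 0 := by
  simp_rw [← Finset.prod_mul_distrib]
  rw [integral_fintype_prod_eq_prod (μ := fun _ : ι => ν)
    (f := fun i x => (C (α i)).indicator (fun _ => (1 : ℝ)) x
      * (C (β i)).indicator (fun _ => (1 : ℝ)) x)]
  have h1 : ∀ i, ∫ x, (C (α i)).indicator (fun _ => (1 : ℝ)) x
      * (C (β i)).indicator (fun _ => (1 : ℝ)) x ∂ν = ν.real (C (α i) ∩ C (β i)) := by
    intro i
    rw [← integral_indicator_one ((hC _).inter (hC _))]
    congr 1; ext x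
    rw [Set.inter_indicator_one]; rfl
  simp_rw [h1]
  split_ifs with h
  · subst h; simp
  · obtain ⟨i, hi⟩ := Function.ne_iff.1 h
    refine Finset.prod_eq_zero (Finset.mem_univ i) ?_
    rw [(hd hi).inter_eq]; simp

omit [MeasurableSpace M] in
lemma prod_indicator_eq {ι : Type*} [Fintype ι] (A : ι → Set M) (z : ι → M) :
    ∏ i, (A i).indicator (fun _ => (1 : ℝ)) (z i)
      = (Set.pi Set.univ A).indicator (fun _ => (1 : ℝ)) z := by
  classical
  by_cases hz : z ∈ Set.pi Set.univ A
  · rw [Set.indicator_of_mem hz]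
    exact Finset.prod_eq_one fun i _ => Set.indicator_of_mem (hz i (Set.mem_univ i)) _
  · rw [Set.indicator_of_notMem hz]
    simp only [Set.mem_pi, Set.mem_univ, true_imp_iff, not_forall] at hz
    obtain ⟨i, hi⟩ := hz
    exact Finset.prod_eq_zero (Finset.mem_univ i) (Set.indicator_of_notMem hi _)

lemma memLp_prod_indicator [SigmaFinite ν] {ι : Type*} [Fintype ι]
    {A : ι → Set M} (hA : ∀ i, MeasurableSet (A i)) (hA' : ∀ i, ν (A i) < ⊤) :
    MemLp (fun z : ι → M => ∏ i, (A i).indicator (fun _ => (1 : ℝ)) (z i)) 2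
      (Measure.pi fun _ : ι => ν) := by
  simp_rw [prod_indicator_eq]
  refine memLp_indicator_const _ (MeasurableSet.univ_pi hA) _ (Or.inr ?_)
  rw [Measure.pi_pi]
  exact (ENNReal.prod_lt_top fun i _ => hA' i).ne

open Classical in
/-- The `L²` bound for combinations of rectangles with sides from one disjoint family, off the
diagonals: monomials in the independent values on the family are orthogonal unless they agree up to
the order of their factors, and each class has at most `rʳ` members. -/
lemma integral_sq_le_of_disjoint [SigmaFinite ν] (hZ : IsGaussianStochasticMeasure ν P Z)
    {τ ι : Type*} [Fintype τ] [Fintype ι]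
    {C : τ → Set M} (hC : ∀ t, MeasurableSet (C t)) (hC' : ∀ t, ν (C t) < ⊤)
    (hd : Pairwise fun t u => Disjoint (C t) (C u)) (c : (ι → τ) → ℝ)
    (hc : ∀ α, ¬ Function.Injective α → c α = 0) :
    ∫ ω, (∑ α, c α * ∏ i, Z (C (α i)) ω) ^ 2 ∂P
      ≤ (Fintype.card ι : ℝ) ^ Fintype.card ι *
        ∫ z, (∑ α, c α * ∏ i, (C (α i)).indicator (fun _ => (1 : ℝ)) (z i)) ^ 2
          ∂(Measure.pi fun _ : ι => ν) := by
  have : IsProbabilityMeasure P := hZ.gaussian.isProbabilityMeasure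
  let v : (ι → τ) → ℝ := fun α => ∏ i, ν.real (C (α i))
  have hv : ∀ α, 0 ≤ v α := fun α => Finset.prod_nonneg fun i _ => measureReal_nonneg
  have hR : ∫ z, (∑ α, c α * ∏ i, (C (α i)).indicator (fun _ => (1 : ℝ)) (z i)) ^ 2
      ∂(Measure.pi fun _ : ι => ν) = ∑ α, c α ^ 2 * v α := by
    have m1 := fun α : ι → τ => memLp_prod_indicator (ν := ν) (A := fun i => C (α i))
      (fun i => hC (α i)) (fun i => hC' (α i))
    simp_rw [sq, Finset.sum_mul_sum]
    have m2 : ∀ α β : ι → τ, Integrable (fun z : ι → M =>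
        (c α * ∏ i, (C (α i)).indicator (fun _ => (1 : ℝ)) (z i))
        * (c β * ∏ i, (C (β i)).indicator (fun _ => (1 : ℝ)) (z i))) (Measure.pi fun _ => ν) :=
      fun α β => ((m1 α).const_mul _).integrable_mul ((m1 β).const_mul _)
    rw [integral_finsetSum _ fun α _ => integrable_finsetSum _ fun β _ => m2 α β]
    refine Finset.sum_congr rfl fun α _ => ?_
    rw [integral_finsetSum _ fun β _ => m2 α β]
    simp_rw [mul_mul_mul_comm, integral_const_mul, integral_prod_indicator_mul hC hd]
    simp [v]
  -- The Gram matrix of the monomials `∏ i, Z (C (α i))` with injective `α`.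
  let m : (ι → τ) → (ι → τ) → ℝ := fun α β =>
    if Function.Injective α ∧ Function.Injective β ∧ Finset.univ.image α = Finset.univ.image β
    then v α else 0
  have hm0 : ∀ α β, 0 ≤ m α β := by
    intro α β; simp only [m]; split_ifs; exacts [hv α, le_rfl]
  have hvim : ∀ α : ι → τ, Function.Injective α →
      v α = ∏ t ∈ Finset.univ.image α, ν.real (C t) := by
    intro α hα; rw [Finset.prod_image fun i _ j _ h => hα h]
  have hmsymm : ∀ α β, m α β = m β α := by
    intro α β
    by_cases h : Function.Injective α ∧ Function.Injective β ∧
      Finset.univ.image α = Finset.univ.image β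
    · simp only [m]
      rw [if_pos h, if_pos ⟨h.2.1, h.1, h.2.2.symm⟩, hvim _ h.1, hvim _ h.2.1, h.2.2]
    · simp only [m]
      rw [if_neg h, if_neg fun h' => h ⟨h'.2.1, h'.1, h'.2.2.symm⟩]
  have hL : ∫ ω, (∑ α, c α * ∏ i, Z (C (α i)) ω) ^ 2 ∂P = ∑ α, ∑ β, c α * c β * m α β := by
    have m1 := fun α : ι → τ => hZ.memLp_prod (A := fun i => C (α i))
      (fun i => hC (α i)) (fun i => hC' (α i))
    simp_rw [sq, Finset.sum_mul_sum]
    have m2 : ∀ α β : ι → τ, Integrable (fun ω =>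
        (c α * ∏ i, Z (C (α i)) ω) * (c β * ∏ i, Z (C (β i)) ω)) P :=
      fun α β => ((m1 α).const_mul _).integrable_mul ((m1 β).const_mul _)
    rw [integral_finsetSum _ fun α _ => integrable_finsetSum _ fun β _ => m2 α β]
    refine Finset.sum_congr rfl fun α _ => ?_
    rw [integral_finsetSum _ fun β _ => m2 α β]
    refine Finset.sum_congr rfl fun β _ => ?_
    simp_rw [mul_mul_mul_comm (c α), integral_const_mul]
    by_cases hα : Function.Injective α
    · by_cases hβ : Function.Injective β
      · congr 1
        have := hZ.integral_prod_mul_prod hC hC' hd (Finset.univ.image α) (Finset.univ.image β)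
        simp_rw [Finset.prod_image fun i _ j _ h => hα h,
          Finset.prod_image fun i _ j _ h => hβ h] at this
        rw [this]
        simp [m, hα, hβ, v]
      · rw [hc β hβ]; ring
    · rw [hc α hα]; ring
  rw [hL, hR, Finset.mul_sum]
  -- `2 c α c β ≤ (c α)² + (c β)²` and the symmetry of `m` leave a row sum of `m` to be bounded.
  have h1 : ∑ α, ∑ β, c α * c β * m α β ≤ ∑ α, ∑ β, c α ^ 2 * m α β := by
    have h2 : ∑ α, ∑ β, c β ^ 2 * m α β = ∑ α, ∑ β, c α ^ 2 * m α β := by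
      rw [Finset.sum_comm]; simp_rw [hmsymm]
    have h3 : ∑ α, ∑ β, c α * c β * m α β
        ≤ ∑ α, ∑ β, (c α ^ 2 * m α β + c β ^ 2 * m α β) / 2 := by
      refine Finset.sum_le_sum fun α _ => Finset.sum_le_sum fun β _ => ?_
      nlinarith [mul_nonneg (sq_nonneg (c α - c β)) (hm0 α β)]
    refine h3.trans_eq ?_
    simp_rw [← Finset.sum_div, Finset.sum_add_distrib, h2]
    ring
  refine h1.trans (Finset.sum_le_sum fun α _ => ?_)
  rw [← Finset.mul_sum, mul_left_comm]
  refine mul_le_mul_of_nonneg_left ?_ (sq_nonneg _)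
  -- Only the `β` with values in the image of `α` contribute to the row of `α`.
  let S : Finset (ι → τ) := Fintype.piFinset fun _ => Finset.univ.image α
  have h4 : ∑ β, m α β = ∑ β ∈ S, m α β := by
    refine (Finset.sum_subset (Finset.subset_univ S) fun β _ hβ => ?_).symm
    simp only [m]
    refine if_neg fun h => hβ ?_
    rw [Fintype.mem_piFinset]
    intro i
    rw [h.2.2]; exact Finset.mem_image_of_mem _ (Finset.mem_univ i)
  have h5 : ∑ β ∈ S, m α β ≤ S.card • v α := by
    refine Finset.sum_le_card_nsmul _ _ _ fun β _ => ?_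
    simp only [m]; split_ifs; exacts [le_rfl, hv α]
  have h6 : S.card ≤ Fintype.card ι ^ Fintype.card ι := by
    simp only [S, Fintype.card_piFinset, Finset.prod_const, Finset.card_univ]
    exact Nat.pow_le_pow_left (Finset.card_image_le.trans_eq Finset.card_univ) _
  rw [h4]
  refine h5.trans ?_
  rw [nsmul_eq_mul]
  exact mul_le_mul_of_nonneg_right (by exact_mod_cast h6) (hv α)

end GaussianMeasure

/-! ### Elementary integrands and the `L²` bound for their integrals -/

section Elementary

variable {M Ω : Type*} [MeasurableSpace M] [MeasurableSpace Ω]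
  {ν : Measure M} {P : Measure Ω} {Z : Set M → Ω → ℝ} {ι : Type*} [Fintype ι]

lemma sum_mul_prod_sum_mul {κ τ : Type*} [Fintype κ] [Fintype τ] [DecidableEq ι] (c : κ → ℝ)
    (a : κ → ι → τ → ℝ) (x : ι → τ → ℝ) :
    ∑ k, c k * ∏ i, ∑ t, a k i t * x i t
      = ∑ α : ι → τ, (∑ k, c k * ∏ i, a k i (α i)) * ∏ i, x i (α i) := by
  simp_rw [Finset.prod_univ_sum, Fintype.piFinset_univ, Finset.prod_mul_distrib, Finset.mul_sum,
    Finset.sum_mul, mul_assoc]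
  exact Finset.sum_comm

namespace ElementaryIntegrand

lemma memLp_toFun [SigmaFinite ν] (e : ElementaryIntegrand ν ι) :
    MemLp e.toFun 2 (Measure.pi fun _ : ι => ν) :=
  memLp_finsetSum _ fun k _ => (memLp_prod_indicator (e.measurable k) (e.finite k)).const_mul _

lemma memLp_integral (hZ : IsGaussianStochasticMeasure ν P Z) [IsProbabilityMeasure P]
    (e : ElementaryIntegrand ν ι) : MemLp (e.integral Z) 2 P :=
  memLp_finsetSum _ fun k _ => (hZ.memLp_prod (e.measurable k) (e.finite k)).const_mul _

/-- The sides of the rectangles of `e` that contain the point `x`. -/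
def pattern (e : ElementaryIntegrand ν ι) (x : M) : Set (Fin e.size × ι) :=
  {j | x ∈ e.side j.1 j.2}

/-- The indices of the common refinement of the sides of `e`: the patterns that occur, so that a
cell cannot lie in two disjoint sides, and are nonempty, so that every cell has finite measure. -/
abbrev Atom (e : ElementaryIntegrand ν ι) : Type _ :=
  {T : Set (Fin e.size × ι) // T.Nonempty ∧ ∃ x, e.pattern x = T}

/-- The set of the points with a given pattern. -/
def cell (e : ElementaryIntegrand ν ι) (T : e.Atom) : Set M := {x | e.pattern x = T.1}

lemma measurableSet_cell (e : ElementaryIntegrand ν ι) (T : e.Atom) :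
    MeasurableSet (e.cell T) := by
  have h : e.cell T = ⋂ j : Fin e.size × ι, {x | x ∈ e.side j.1 j.2 ↔ j ∈ T.1} := by
    ext x; simp [cell, pattern, Set.ext_iff]
  rw [h]
  refine MeasurableSet.iInter fun j => ?_
  by_cases hj : j ∈ T.1
  · simpa [hj] using e.measurable j.1 j.2
  · simp only [hj, iff_false]
    exact (e.measurable j.1 j.2).compl

omit [Fintype ι] in
lemma cell_subset_side (e : ElementaryIntegrand ν ι) (T : e.Atom) {j : Fin e.size × ι}
    (hj : j ∈ T.1) : e.cell T ⊆ e.side j.1 j.2 := by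
  intro x hx
  have hx : e.pattern x = T.1 := hx
  rw [← hx] at hj
  exact hj

omit [Fintype ι] in
lemma measure_cell_lt_top (e : ElementaryIntegrand ν ι) (T : e.Atom) : ν (e.cell T) < ⊤ := by
  obtain ⟨j, hj⟩ := T.2.1
  exact (measure_mono (e.cell_subset_side T hj)).trans_lt (e.finite _ _)

omit [Fintype ι] in
lemma disjoint_cell (e : ElementaryIntegrand ν ι) :
    Pairwise fun T U : e.Atom => Disjoint (e.cell T) (e.cell U) := by
  intro T U hTU
  refine Set.disjoint_left.2 fun x hx hx' => hTU (Subtype.ext ?_)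
  exact Eq.trans (Eq.symm hx) hx'

open Classical in
lemma side_eq_biUnion_cell (e : ElementaryIntegrand ν ι) (j : Fin e.size × ι) :
    e.side j.1 j.2 = ⋃ T ∈ Finset.univ.filter (fun T : e.Atom => j ∈ T.1), e.cell T := by
  ext x
  simp only [Finset.mem_filter, Finset.mem_univ, true_and, Set.mem_iUnion, exists_prop]
  constructor
  · intro hx
    exact ⟨⟨e.pattern x, ⟨j, hx⟩, x, rfl⟩, hx, rfl⟩
  · rintro ⟨T, hj, hx⟩
    exact e.cell_subset_side T hj hx

open Classical in
/-- The coefficient of the rectangle `∏ i, cell (α i)` in the refinement of `e`. -/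
noncomputable def cellCoeff (e : ElementaryIntegrand ν ι) (α : ι → e.Atom) : ℝ :=
  ∑ k, e.coeff k * ∏ i, if (k, i) ∈ (α i).1 then 1 else 0

/-- The refinement of an elementary integrand vanishes on the diagonals, because the sides of a
rectangle are disjoint. -/
lemma cellCoeff_eq_zero (e : ElementaryIntegrand ν ι) {α : ι → e.Atom}
    (hα : ¬ Function.Injective α) : e.cellCoeff α = 0 := by
  classical
  simp only [Function.Injective, not_forall] at hα
  obtain ⟨i, j, hij, hne⟩ := hα
  refine Finset.sum_eq_zero fun k _ => ?_
  by_cases hi : (k, i) ∈ (α i).1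
  · by_cases hj : (k, j) ∈ (α j).1
    · obtain ⟨x, hx⟩ := (α i).2.2
      rw [← hij] at hj
      rw [← hx] at hi hj
      exact (Set.disjoint_left.1 (e.disjoint k i j hne) hi hj).elim
    · rw [Finset.prod_eq_zero (Finset.mem_univ j) (if_neg hj), mul_zero]
  · rw [Finset.prod_eq_zero (Finset.mem_univ i) (if_neg hi), mul_zero]

open Classical in
lemma toFun_eq_sum_cell (e : ElementaryIntegrand ν ι) (z : ι → M) :
    e.toFun z = ∑ α : ι → e.Atom,
      e.cellCoeff α * ∏ i, (e.cell (α i)).indicator (fun _ => (1 : ℝ)) (z i) := by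
  unfold toFun cellCoeff
  rw [← sum_mul_prod_sum_mul e.coeff (fun k i T => if (k, i) ∈ T.1 then 1 else 0)
    (fun i T => (e.cell T).indicator (fun _ => (1 : ℝ)) (z i))]
  refine Finset.sum_congr rfl fun k _ => ?_
  congr 1
  refine Finset.prod_congr rfl fun i _ => ?_
  have h := e.side_eq_biUnion_cell (k, i)
  simp only at h
  rw [h, Finset.indicator_biUnion_apply _ _ fun T _ U _ hTU => e.disjoint_cell hTU,
    Finset.sum_filter]
  exact Finset.sum_congr rfl fun T _ => by split_ifs <;> simp

open Classical in
lemma integral_ae_eq_sum_cell (hZ : IsGaussianStochasticMeasure ν P Z)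
    (e : ElementaryIntegrand ν ι) :
    e.integral Z =ᵐ[P] fun ω => ∑ α : ι → e.Atom,
      e.cellCoeff α * ∏ i, Z (e.cell (α i)) ω := by
  have h : ∀ k i, Z (e.side k i) =ᵐ[P] fun ω =>
      ∑ T : e.Atom, (if (k, i) ∈ T.1 then 1 else 0) * Z (e.cell T) ω := by
    intro k i
    refine (hZ.ae_eq_sum _ e.measurableSet_cell e.measure_cell_lt_top e.disjoint_cell
      (e.measurable k i) (e.side_eq_biUnion_cell (k, i))).trans (Eventually.of_forall fun ω => ?_)
    simp only [Finset.sum_filter]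
    exact Finset.sum_congr rfl fun T _ => by split_ifs <;> simp
  have h' : ∀ᵐ ω ∂P, ∀ k i, Z (e.side k i) ω =
      ∑ T : e.Atom, (if (k, i) ∈ T.1 then 1 else 0) * Z (e.cell T) ω :=
    ae_all_iff.2 fun k => eventually_all.2 fun i => h k i
  filter_upwards [h'] with ω hω
  unfold integral cellCoeff
  rw [← sum_mul_prod_sum_mul e.coeff (fun k i T => if (k, i) ∈ T.1 then 1 else 0)
    (fun _ T => Z (e.cell T) ω)]
  simp_rw [hω]

/-- The `L²` bound for elementary integrands: refine all sides to one disjoint family. -/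
lemma integral_sq_le [SigmaFinite ν] (hZ : IsGaussianStochasticMeasure ν P Z)
    (e : ElementaryIntegrand ν ι) :
    ∫ ω, e.integral Z ω ^ 2 ∂P ≤ (Fintype.card ι : ℝ) ^ Fintype.card ι *
      ∫ z, e.toFun z ^ 2 ∂(Measure.pi fun _ : ι => ν) := by
  classical
  simp_rw [e.toFun_eq_sum_cell]
  rw [integral_congr_ae ((e.integral_ae_eq_sum_cell hZ).mono fun ω hω => by rw [hω])]
  exact integral_sq_le_of_disjoint hZ e.measurableSet_cell e.measure_cell_lt_top e.disjoint_cell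
    e.cellCoeff fun α hα => e.cellCoeff_eq_zero hα

/-- The operator norm bound `√(rʳ)` for the `r`-fold multiple stochastic integral. -/
noncomputable def integralBound (ι : Type*) [Fintype ι] : ENNReal :=
  ENNReal.ofReal (Real.sqrt ((Fintype.card ι : ℝ) ^ Fintype.card ι))

lemma eLpNorm_integral_le [SigmaFinite ν] [IsProbabilityMeasure P]
    (hZ : IsGaussianStochasticMeasure ν P Z) (e : ElementaryIntegrand ν ι) :
    eLpNorm (e.integral Z) 2 P
      ≤ integralBound ι * eLpNorm e.toFun 2 (Measure.pi fun _ : ι => ν) := by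
  rw [(e.memLp_integral hZ).eLpNorm_eq_integral_rpow_norm (by simp) (by simp),
    e.memLp_toFun.eLpNorm_eq_integral_rpow_norm (by simp) (by simp), integralBound,
    ← ENNReal.ofReal_mul (Real.sqrt_nonneg _)]
  refine ENNReal.ofReal_le_ofReal ?_
  simp only [ENNReal.toReal_ofNat, Real.rpow_ofNat, Real.norm_eq_abs, sq_abs]
  rw [← one_div, ← Real.sqrt_eq_rpow, ← Real.sqrt_eq_rpow, ← Real.sqrt_mul (by positivity)]
  exact Real.sqrt_le_sqrt (e.integral_sq_le hZ)

/-- The sum of two elementary integrands, as the concatenation of the two representations. -/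
def add (e e' : ElementaryIntegrand ν ι) : ElementaryIntegrand ν ι where
  size := e.size + e'.size
  coeff := Fin.append e.coeff e'.coeff
  side := Fin.append e.side e'.side
  measurable k := by
    refine Fin.addCases (fun k => ?_) (fun k => ?_) k <;> simp [e.measurable, e'.measurable]
  finite k := by
    refine Fin.addCases (fun k => ?_) (fun k => ?_) k <;> simp [e.finite, e'.finite]
  disjoint k := by
    refine Fin.addCases (fun k => ?_) (fun k => ?_) k
    · simpa using e.disjoint k
    · simpa using e'.disjoint k

/-- A scalar multiple of an elementary integrand. -/
def smul (c : ℝ) (e : ElementaryIntegrand ν ι) : ElementaryIntegrand ν ι where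
  __ := e
  coeff k := c * e.coeff k

lemma add_toFun (e e' : ElementaryIntegrand ν ι) (z : ι → M) :
    (e.add e').toFun z = e.toFun z + e'.toFun z := by
  change ∑ k : Fin (e.size + e'.size), _ = _
  rw [Fin.sum_univ_add]
  simp [toFun, add]

omit [MeasurableSpace Ω] in
lemma add_integral (e e' : ElementaryIntegrand ν ι) (ω : Ω) :
    (e.add e').integral Z ω = e.integral Z ω + e'.integral Z ω := by
  change ∑ k : Fin (e.size + e'.size), _ = _
  rw [Fin.sum_univ_add]
  simp [integral, add]

lemma smul_toFun (c : ℝ) (e : ElementaryIntegrand ν ι) (z : ι → M) :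
    (e.smul c).toFun z = c * e.toFun z := by
  simp only [toFun, smul, Finset.mul_sum, mul_assoc]; rfl

omit [MeasurableSpace Ω] in
lemma smul_integral (c : ℝ) (e : ElementaryIntegrand ν ι) (ω : Ω) :
    (e.smul c).integral Z ω = c * e.integral Z ω := by
  simp only [integral, smul, Finset.mul_sum, mul_assoc]; rfl

/-- The difference of two elementary integrands. -/
def sub (e e' : ElementaryIntegrand ν ι) : ElementaryIntegrand ν ι := e.add (e'.smul (-1))

lemma sub_toFun (e e' : ElementaryIntegrand ν ι) (z : ι → M) :
    (e.sub e').toFun z = e.toFun z - e'.toFun z := by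
  simp only [sub, add_toFun, smul_toFun]; ring

omit [MeasurableSpace Ω] in
lemma sub_integral (e e' : ElementaryIntegrand ν ι) (ω : Ω) :
    (e.sub e').integral Z ω = e.integral Z ω - e'.integral Z ω := by
  simp only [sub, add_integral, smul_integral]; ring

end ElementaryIntegrand

/-- The functions in the closure of the elementary integrands in `L²(ν^ι)`. -/
def ElementaryApprox (ν : Measure M) (g : (ι → M) → ℝ) : Prop :=
  ∀ ε : ENNReal, ε ≠ 0 → ∃ e : ElementaryIntegrand ν ι,
    eLpNorm (fun z => e.toFun z - g z) 2 (Measure.pi fun _ : ι => ν) ≤ ε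

namespace ElementaryApprox

variable [SigmaFinite ν] {g g' : (ι → M) → ℝ}

lemma add (hg : ElementaryApprox ν g) (hg' : ElementaryApprox ν g')
    (hm : AEStronglyMeasurable g (Measure.pi fun _ : ι => ν))
    (hm' : AEStronglyMeasurable g' (Measure.pi fun _ : ι => ν)) :
    ElementaryApprox ν (fun z => g z + g' z) := by
  intro ε hε
  obtain ⟨e, he⟩ := hg (ε / 2) (by simpa using hε)
  obtain ⟨e', he'⟩ := hg' (ε / 2) (by simpa using hε)
  refine ⟨e.add e', ?_⟩
  have h : (fun z => (e.add e').toFun z - (g z + g' z))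
      = (fun z => e.toFun z - g z) + fun z => e'.toFun z - g' z := by
    ext z; simp only [Pi.add_apply, ElementaryIntegrand.add_toFun]; ring
  rw [h]
  refine (eLpNorm_add_le (e.memLp_toFun.1.sub hm) (e'.memLp_toFun.1.sub hm') (by simp)).trans ?_
  exact (add_le_add he he').trans_eq (ENNReal.add_halves ε)

omit [SigmaFinite ν] in
lemma const_mul (hg : ElementaryApprox ν g) (c : ℝ) : ElementaryApprox ν (fun z => c * g z) := by
  intro ε hε
  obtain ⟨δ, hδ, h⟩ : ∃ δ : ENNReal, δ ≠ 0 ∧ ‖c‖ₑ * δ ≤ ε := by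
    refine ⟨ε / ‖c‖ₑ, ENNReal.div_ne_zero.2 ⟨hε, enorm_ne_top⟩, ENNReal.mul_div_le⟩
  obtain ⟨e, he⟩ := hg δ hδ
  refine ⟨e.smul c, ?_⟩
  have h' : (fun z => (e.smul c).toFun z - c * g z) = c • fun z => e.toFun z - g z := by
    ext z; simp only [Pi.smul_apply, smul_eq_mul, ElementaryIntegrand.smul_toFun]; ring
  rw [h', eLpNorm_const_smul]
  exact (mul_le_mul_right he _).trans h

/-- The closure of the elementary integrands is closed under dominated pointwise limits. -/
lemma of_tendsto {h : ℕ → (ι → M) → ℝ} (hh : ∀ m, ElementaryApprox ν (h m))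
    (hm : ∀ m, AEStronglyMeasurable (h m) (Measure.pi fun _ : ι => ν))
    {b : (ι → M) → ℝ} (hb : MemLp b 2 (Measure.pi fun _ : ι => ν))
    (hbound : ∀ m z, |h m z| ≤ b z)
    (hlim : ∀ᵐ z ∂(Measure.pi fun _ : ι => ν), Tendsto (fun m => h m z) atTop (𝓝 (g z))) :
    ElementaryApprox ν g := by
  have hgm : AEStronglyMeasurable g (Measure.pi fun _ : ι => ν) :=
    aestronglyMeasurable_of_tendsto_ae atTop hm hlim
  have hgb : ∀ᵐ z ∂(Measure.pi fun _ : ι => ν), ‖g z‖ ≤ b z := by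
    filter_upwards [hlim] with z hz
    exact le_of_tendsto hz.norm (Eventually.of_forall fun m => hbound m z)
  have hg : MemLp g 2 (Measure.pi fun _ : ι => ν) := hb.of_le hgm
    (hgb.mono fun z hz => hz.trans (le_abs_self _))
  have hmem : ∀ m, MemLp (fun z => h m z - g z) 2 (Measure.pi fun _ : ι => ν) := fun m =>
    (hb.of_le (hm m) (Eventually.of_forall fun z => (hbound m z).trans (le_abs_self _))).sub hg
  have hint : Tendsto (fun m => ∫ z, ‖h m z - g z‖ ^ (2 : ℝ) ∂(Measure.pi fun _ : ι => ν))
      atTop (𝓝 (∫ _, 0 ∂(Measure.pi fun _ : ι => ν))) := by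
    refine tendsto_integral_of_dominated_convergence (fun z => (2 * b z) ^ 2)
      (fun m => ((hmem m).integrable_norm_rpow (by simp) (by simp)).1)
      (hb.const_mul 2).integrable_sq (fun m => ?_) ?_
    · filter_upwards [hgb] with z hz
      rw [Real.rpow_ofNat, Real.norm_of_nonneg (sq_nonneg _)]
      refine pow_le_pow_left₀ (norm_nonneg _) ((norm_sub_le _ _).trans ?_) 2
      rw [two_mul]
      exact add_le_add (hbound m z) hz
    · filter_upwards [hlim] with z hz
      have : Tendsto (fun m => ‖h m z - g z‖ ^ 2) atTop (𝓝 (‖g z - g z‖ ^ 2)) :=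
        ((hz.sub_const _).norm).pow 2
      simpa using this
  have hconv : Tendsto (fun m => eLpNorm (fun z => h m z - g z) 2 (Measure.pi fun _ : ι => ν))
      atTop (𝓝 0) := by
    have h1 := (ENNReal.continuous_ofReal.tendsto _).comp (hint.sqrt)
    rw [integral_zero, Real.sqrt_zero, ENNReal.ofReal_zero] at h1
    refine h1.congr fun m => ?_
    rw [(hmem m).eLpNorm_eq_integral_rpow_norm (by simp) (by simp), ENNReal.toReal_ofNat,
      ← one_div, ← Real.sqrt_eq_rpow]
    rfl
  intro ε hε
  have hε2 : ε / 2 ≠ 0 := by simpa using hε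
  obtain ⟨m, hm1⟩ := (hconv.eventually (ge_mem_nhds (pos_iff_ne_zero.2 hε2))).exists
  obtain ⟨e, he⟩ := hh m (ε / 2) hε2
  refine ⟨e, ?_⟩
  have h2 : (fun z => e.toFun z - g z) = (fun z => e.toFun z - h m z) + fun z => h m z - g z := by
    ext z; simp
  rw [h2]
  refine (eLpNorm_add_le (e.memLp_toFun.1.sub (hm m)) (hmem m).1 (by simp)).trans ?_
  exact (add_le_add he hm1).trans_eq (ENNReal.add_halves ε)

end ElementaryApprox

end Elementary

/-! ### Density of the elementary integrands -/

section Density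

variable {M : Type*} [MeasurableSpace M] {ν : Measure M} {ι : Type*} [Fintype ι]

/-- For an atomless measure, almost every point of the product has distinct coordinates. -/
lemma ae_injective_pi [SigmaFinite ν] [NullSingletonClass ν] [MeasurableEq M] :
    ∀ᵐ z ∂(Measure.pi fun _ : ι => ν), Function.Injective z := by
  classical
  have key : ∀ i j : ι, i ≠ j → ∀ᵐ z ∂(Measure.pi fun _ : ι => ν), z i ≠ z j := by
    intro i j hij
    have hp := measurePreserving_piEquivPiSubtypeProd (fun _ : ι => ν) (fun k => k = i)
    have hs : MeasurableSet {q : ({k // k = i} → M) × ({k // ¬ k = i} → M) |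
        q.1 ⟨i, rfl⟩ = q.2 ⟨j, hij.symm⟩} := by
      apply measurableSet_eq_fun <;> fun_prop
    refine hp.quasiMeasurePreserving.ae (p := fun q => q.1 ⟨i, rfl⟩ ≠ q.2 ⟨j, hij.symm⟩) ?_
    · rw [ae_iff]
      simp only [ne_eq, not_not]
      rw [Measure.measure_prod_null hs]
      refine Eventually.of_forall fun x => ?_
      have := Measure.pi_hyperplane (fun _ : {k // ¬ k = i} => ν) ⟨j, hij.symm⟩ (x ⟨i, rfl⟩)
      simpa [Set.preimage, eq_comm] using this
  have : ∀ᵐ z ∂(Measure.pi fun _ : ι => ν), ∀ i j, i ≠ j → z i ≠ z j :=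
    eventually_all.2 fun i => eventually_all.2 fun j => by
      by_cases h : i = j
      · exact Eventually.of_forall fun z h' => (h' h).elim
      · filter_upwards [key i j h] with z hz _ using hz
  filter_upwards [this] with z hz i j h
  by_contra hne
  exact hz i j hne h

lemma ElementaryApprox.of_toFun (e : ElementaryIntegrand ν ι) : ElementaryApprox ν e.toFun :=
  fun ε _ => ⟨e, by simp⟩

/-- The first `m` of the countably many binary digits that separate the points of `M`. -/
noncomputable def digits (M : Type*) [MeasurableSpace M] [MeasurableSpace.CountablyGenerated M]
    (m : ℕ) (x : M) : Fin m → Bool := fun j => MeasurableSpace.mapNatBool M x j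

variable [MeasurableSpace.CountablyGenerated M]

lemma measurable_digits (m : ℕ) : Measurable (digits M m) :=
  measurable_pi_lambda _ fun _ =>
    (measurable_pi_apply _).comp (MeasurableSpace.measurable_mapNatBool M)

/-- Points with distinct coordinates are separated by all sufficiently long digit sequences. -/
lemma eventually_injective_digits [MeasurableSpace.SeparatesPoints M] {z : ι → M}
    (hz : Function.Injective z) :
    ∀ᶠ m in atTop, Function.Injective fun i => digits M m (z i) := by
  have h : ∀ i j, i ≠ j → ∀ᶠ m in atTop, digits M m (z i) ≠ digits M m (z j) := by
    intro i j hij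
    have := (MeasurableSpace.injective_mapNatBool M).ne (hz.ne hij)
    obtain ⟨n, hn⟩ := Function.ne_iff.1 this
    filter_upwards [eventually_gt_atTop n] with m hm heq
    exact hn (congrFun heq ⟨n, hm⟩)
  have : ∀ᶠ m in atTop, ∀ i j, i ≠ j → digits M m (z i) ≠ digits M m (z j) :=
    eventually_all.2 fun i => eventually_all.2 fun j => by
      by_cases hij : i = j
      · exact Eventually.of_forall fun z h' => (h' hij).elim
      · filter_upwards [h i j hij] with m hm _ using hm
  filter_upwards [this] with m hm i j heq
  by_contra hne
  exact hm i j hne heq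

open Classical in
/-- The part of the rectangle `∏ i, A i` where the digit sequences of the coordinates differ. -/
noncomputable def offDiagonalRect (ν : Measure M) (A : ι → Set M) (hA : ∀ i, MeasurableSet (A i))
    (hA' : ∀ i, ν (A i) < ⊤) (m : ℕ) : ElementaryIntegrand ν ι where
  size := Fintype.card {α : ι → Fin m → Bool // Function.Injective α}
  coeff _ := 1
  side k i := A i ∩ digits M m ⁻¹' {((Fintype.equivFin _).symm k).1 i}
  measurable k i := (hA i).inter (measurable_digits m (MeasurableSet.singleton _))
  finite k i := (measure_mono Set.inter_subset_left).trans_lt (hA' i)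
  disjoint k i j hij := by
    refine Set.disjoint_left.2 fun x hx hx' => hij ?_
    exact ((Fintype.equivFin _).symm k).2 (hx.2.symm.trans hx'.2)

open Classical in
lemma offDiagonalRect_toFun {A : ι → Set M} (hA : ∀ i, MeasurableSet (A i))
    (hA' : ∀ i, ν (A i) < ⊤) (m : ℕ) (z : ι → M) :
    (offDiagonalRect ν A hA hA' m).toFun z
      = if Function.Injective (fun i => digits M m (z i)) then
          ∏ i, (A i).indicator (fun _ => (1 : ℝ)) (z i) else 0 := by
  have h1 : (offDiagonalRect ν A hA hA' m).toFun z
      = ∑ α : {α : ι → Fin m → Bool // Function.Injective α},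
        ∏ i, (A i ∩ digits M m ⁻¹' {α.1 i}).indicator (fun _ => (1 : ℝ)) (z i) := by
    rw [← (Fintype.equivFin _).symm.sum_comp]
    simp only [ElementaryIntegrand.toFun, offDiagonalRect, one_mul]
    rfl
  rw [h1]
  split_ifs with h
  · rw [Finset.sum_eq_single_of_mem (⟨_, h⟩ : {α : ι → Fin m → Bool // Function.Injective α})
      (Finset.mem_univ _)]
    · refine Finset.prod_congr rfl fun i _ => ?_
      by_cases hi : z i ∈ A i <;> simp [Set.indicator, hi]
    · intro α _ hα
      obtain ⟨i, hi⟩ : ∃ i, digits M m (z i) ≠ α.1 i := by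
        by_contra! hcon
        exact hα (Subtype.ext (funext fun i => (hcon i).symm))
      exact Finset.prod_eq_zero (Finset.mem_univ i)
        (Set.indicator_of_notMem (fun hx => hi hx.2) _)
  · refine Finset.sum_eq_zero fun α _ => ?_
    obtain ⟨i, hi⟩ : ∃ i, digits M m (z i) ≠ α.1 i := by
      by_contra! hcon
      exact h (by simpa only [hcon] using α.2)
    exact Finset.prod_eq_zero (Finset.mem_univ i)
      (Set.indicator_of_notMem (fun hx => hi hx.2) _)

variable [MeasurableSpace.SeparatesPoints M] [MeasurableEq M] [SigmaFinite ν] [NullSingletonClass ν]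

/-- Rectangles are limits of elementary integrands, since the diagonals are null sets. -/
lemma elementaryApprox_rect {A : ι → Set M} (hA : ∀ i, MeasurableSet (A i))
    (hA' : ∀ i, ν (A i) < ⊤) :
    ElementaryApprox ν (fun z : ι → M => ∏ i, (A i).indicator (fun _ => (1 : ℝ)) (z i)) := by
  classical
  refine ElementaryApprox.of_tendsto (h := fun m => (offDiagonalRect ν A hA hA' m).toFun)
    (fun m => .of_toFun _) (fun m => ElementaryIntegrand.memLp_toFun _ |>.1)
    (memLp_prod_indicator hA hA') (fun m z => ?_) ?_
  · have h0 : 0 ≤ ∏ i, (A i).indicator (fun _ => (1 : ℝ)) (z i) :=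
      Finset.prod_nonneg fun i _ => Set.indicator_nonneg (fun _ _ => zero_le_one) _
    rw [offDiagonalRect_toFun]
    split_ifs
    · rw [abs_of_nonneg h0]
    · simpa using h0
  · filter_upwards [ae_injective_pi (ν := ν) (ι := ι)] with z hz
    refine tendsto_const_nhds.congr' ?_
    filter_upwards [eventually_injective_digits hz] with m hm
    rw [offDiagonalRect_toFun, if_pos hm]

/-- Measurable subsets of a box of finite measure are limits of elementary integrands: these sets
form a `λ`-system that contains the rectangles. -/
lemma elementaryApprox_inter_box {B : Set M} (hB : MeasurableSet B) (hB' : ν B < ⊤)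
    {S : Set (ι → M)} (hS : MeasurableSet S) :
    ElementaryApprox ν ((S ∩ Set.pi Set.univ fun _ => B).indicator fun _ => (1 : ℝ)) := by
  have hbox : MeasurableSet (Set.pi Set.univ fun _ : ι => B) := MeasurableSet.univ_pi fun _ => hB
  have hboxfin : (Measure.pi fun _ : ι => ν) (Set.pi Set.univ fun _ : ι => B) ≠ ⊤ := by
    rw [Measure.pi_pi]; exact (ENNReal.prod_lt_top fun i _ => hB').ne
  have hmeas : ∀ T : Set (ι → M), MeasurableSet T → AEStronglyMeasurable
      (T.indicator fun _ => (1 : ℝ)) (Measure.pi fun _ : ι => ν) := fun T hT =>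
    (stronglyMeasurable_const.indicator hT).aestronglyMeasurable
  have hrect : ∀ A : ι → Set M, (∀ i, MeasurableSet (A i)) → ElementaryApprox ν
      ((Set.pi Set.univ A ∩ Set.pi Set.univ fun _ => B).indicator fun _ => (1 : ℝ)) := by
    intro A hA
    have := elementaryApprox_rect (ν := ν) (A := fun i => A i ∩ B) (fun i => (hA i).inter hB)
      (fun i => (measure_mono Set.inter_subset_right).trans_lt hB')
    simp_rw [prod_indicator_eq] at this
    rwa [← Set.pi_inter_distrib]
  have hzero : ElementaryApprox ν (fun _ : ι → M => (0 : ℝ)) := by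
    simpa using (hrect (fun _ => ∅) fun _ => .empty).const_mul 0
  induction S, hS using MeasurableSpace.induction_on_inter
    (generateFrom_pi (α := fun _ : ι => M)).symm isPiSystem_pi with
  | empty => simpa using hzero
  | basic T hT =>
    obtain ⟨A, hA, rfl⟩ := hT
    exact hrect A fun i => hA i (Set.mem_univ i)
  | compl T hT ih =>
    have h1 := (hrect (fun _ => Set.univ) (fun _ => .univ)).add (ih.const_mul (-1))
      (hmeas _ ((MeasurableSet.univ_pi fun _ => .univ).inter hbox))
      ((hmeas _ (hT.inter hbox)).const_mul _)
    convert h1 using 2 with z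
    by_cases hz : z ∈ T <;> by_cases hz' : z ∈ Set.pi Set.univ fun _ : ι => B <;>
      simp [Set.indicator, hz, hz']
  | iUnion f hd hf ih =>
    have hsum : ∀ (m : ℕ) (z : ι → M), ∑ k ∈ Finset.range m,
        (f k ∩ Set.pi Set.univ fun _ => B).indicator (fun _ => (1 : ℝ)) z
          = (⋃ k ∈ Finset.range m, f k ∩ Set.pi Set.univ fun _ => B).indicator
            (fun _ => (1 : ℝ)) z := fun m z =>
      (Finset.indicator_biUnion_apply _ _ (fun k _ l _ hkl =>
        ((hd hkl).mono Set.inter_subset_left Set.inter_subset_left)) z).symm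
    refine ElementaryApprox.of_tendsto (h := fun m z => ∑ k ∈ Finset.range m,
      (f k ∩ Set.pi Set.univ fun _ => B).indicator (fun _ => (1 : ℝ)) z)
      (b := (Set.pi Set.univ fun _ : ι => B).indicator fun _ => (1 : ℝ)) (fun m => ?_)
      (fun m => ?_) (memLp_indicator_const _ hbox _ (Or.inr hboxfin)) (fun m z => ?_)
      (Eventually.of_forall fun z => ?_)
    · induction m with
      | zero => simpa using hzero
      | succ m ihm =>
        simp_rw [Finset.sum_range_succ]
        exact ihm.add (ih m) (Finset.aestronglyMeasurable_fun_sum _ fun k _ =>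
          hmeas _ ((hf k).inter hbox)) (hmeas _ ((hf m).inter hbox))
    · exact Finset.aestronglyMeasurable_fun_sum _ fun k _ => hmeas _ ((hf k).inter hbox)
    · rw [hsum, abs_of_nonneg (Set.indicator_nonneg (fun _ _ => zero_le_one) _)]
      refine Set.indicator_le_indicator_of_subset ?_ (fun _ => zero_le_one) z
      exact Set.iUnion₂_subset fun k _ => Set.inter_subset_right
    · simp_rw [hsum]
      by_cases hz : z ∈ (⋃ k, f k) ∩ Set.pi Set.univ fun _ => B
      · obtain ⟨n, hn⟩ := Set.mem_iUnion.1 hz.1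
        refine tendsto_const_nhds.congr' ?_
        filter_upwards [eventually_gt_atTop n] with m hm
        rw [Set.indicator_of_mem hz, Set.indicator_of_mem]
        exact Set.mem_biUnion (Finset.mem_coe.2 (Finset.mem_range.2 hm)) ⟨hn, hz.2⟩
      · refine tendsto_const_nhds.congr fun m => ?_
        rw [Set.indicator_of_notMem hz, Set.indicator_of_notMem]
        intro h
        obtain ⟨k, _, hk⟩ := Set.mem_iUnion₂.1 h
        exact hz ⟨Set.mem_iUnion.2 ⟨k, hk.1⟩, hk.2⟩

/-- Elementary integrands are dense in `L²(ν^ι)`. -/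
theorem elementaryApprox_of_memLp {g : (ι → M) → ℝ}
    (hg : MemLp g 2 (Measure.pi fun _ : ι => ν)) : ElementaryApprox ν g := by
  have hset : ∀ S : Set (ι → M), MeasurableSet S → (Measure.pi fun _ : ι => ν) S < ⊤ →
      ElementaryApprox ν (S.indicator fun _ => (1 : ℝ)) := by
    intro S hS hS'
    refine ElementaryApprox.of_tendsto (h := fun m =>
      (S ∩ Set.pi Set.univ fun _ => spanningSets ν m).indicator fun _ => (1 : ℝ))
      (b := S.indicator fun _ => (1 : ℝ))
      (fun m => elementaryApprox_inter_box (measurableSet_spanningSets ν m)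
        (measure_spanningSets_lt_top ν m) hS)
      (fun m => (stronglyMeasurable_const.indicator (hS.inter (MeasurableSet.univ_pi
        fun _ => measurableSet_spanningSets ν m))).aestronglyMeasurable)
      (memLp_indicator_const _ hS _ (Or.inr hS'.ne)) (fun m z => ?_)
      (Eventually.of_forall fun z => ?_)
    · rw [abs_of_nonneg (Set.indicator_nonneg (fun _ _ => zero_le_one) _)]
      exact Set.indicator_le_indicator_of_subset Set.inter_subset_left (fun _ => zero_le_one) z
    · refine tendsto_const_nhds.congr' ?_
      have : ∀ᶠ m in atTop, ∀ i, z i ∈ spanningSets ν m :=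
        eventually_all.2 fun i => eventually_mem_spanningSets ν (z i)
      filter_upwards [this] with m hm
      have hmem : z ∈ Set.pi Set.univ fun _ : ι => spanningSets ν m := fun i _ => hm i
      by_cases hz : z ∈ S <;> simp [Set.indicator, hz, hmem] at hmem ⊢
  intro ε hε
  obtain ⟨g', hg', e, rfl⟩ := hg.induction_dense (by simp)
    (fun h => ∃ e : ElementaryIntegrand ν ι, h = e.toFun) (fun c S hS hS' δ hδ => by
      obtain ⟨e, he⟩ := (hset S hS hS').const_mul c δ hδ
      refine ⟨e.toFun, ?_, e, rfl⟩
      convert he using 2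
      ext z
      by_cases hz : z ∈ S <;> simp [hz])
    (by
      rintro _ _ ⟨e, rfl⟩ ⟨e', rfl⟩
      exact ⟨e.add e', funext fun z => (e.add_toFun e' z).symm⟩)
    (by rintro _ ⟨e, rfl⟩; exact e.memLp_toFun.1) hε
  refine ⟨e, ?_⟩
  rw [← eLpNorm_sub_comm] at hg'
  exact hg'

end Density

/-! ### Existence, uniqueness and continuity of the multiple stochastic integral -/

section MultipleIntegral

variable {M Ω : Type*} [MeasurableSpace M] [MeasurableSpace Ω]
  {ν : Measure M} {P : Measure Ω} {Z : Set M → Ω → ℝ} {ι : Type*} [Fintype ι]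

lemma HasMultipleIntegral.congr {g : (ι → M) → ℝ} {X X' : Ω → ℝ}
    (h : HasMultipleIntegral ν P Z g X) (hX : X' =ᵐ[P] X) : HasMultipleIntegral ν P Z g X' := by
  obtain ⟨hg, hX', e, he, hI⟩ := h
  refine ⟨hg, hX'.ae_eq hX.symm, e, he, hI.congr fun k => eLpNorm_congr_ae ?_⟩
  filter_upwards [hX] with ω hω
  rw [hω]

variable [SigmaFinite ν] [IsProbabilityMeasure P]

lemma ElementaryIntegrand.eLpNorm_integral_sub_le (hZ : IsGaussianStochasticMeasure ν P Z)
    (e e' : ElementaryIntegrand ν ι) :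
    eLpNorm (fun ω => e.integral Z ω - e'.integral Z ω) 2 P ≤ integralBound ι *
      eLpNorm (fun z => e.toFun z - e'.toFun z) 2 (Measure.pi fun _ : ι => ν) := by
  have := (e.sub e').eLpNorm_integral_le hZ
  convert this using 3
  · exact (e.sub_integral e' _).symm
  · ext z; exact (e.sub_toFun e' z).symm

lemma eLpNorm_sub_le_add {α : Type*} [MeasurableSpace α] {ρ : Measure α} {a b c : α → ℝ}
    (ha : AEStronglyMeasurable a ρ) (hb : AEStronglyMeasurable b ρ)
    (hc : AEStronglyMeasurable c ρ) :
    eLpNorm (fun x => a x - c x) 2 ρ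
      ≤ eLpNorm (fun x => a x - b x) 2 ρ + eLpNorm (fun x => b x - c x) 2 ρ := by
  have h : (fun x => a x - c x) = (fun x => a x - b x) + fun x => b x - c x := by ext x; simp
  rw [h]
  exact eLpNorm_add_le (ha.sub hb) (hb.sub hc) (by simp)

lemma eLpNorm_fun_sub_comm {α : Type*} [MeasurableSpace α] {ρ : Measure α} (a b : α → ℝ) :
    eLpNorm (fun x => a x - b x) 2 ρ = eLpNorm (fun x => b x - a x) 2 ρ :=
  eLpNorm_sub_comm a b 2 ρ

/-- The multiple stochastic integral is bounded in `L²`. -/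
lemma HasMultipleIntegral.eLpNorm_sub_le (hZ : IsGaussianStochasticMeasure ν P Z)
    {g g' : (ι → M) → ℝ} {X X' : Ω → ℝ} (h : HasMultipleIntegral ν P Z g X)
    (h' : HasMultipleIntegral ν P Z g' X') :
    eLpNorm (fun ω => X ω - X' ω) 2 P ≤ ElementaryIntegrand.integralBound ι *
      eLpNorm (fun z => g z - g' z) 2 (Measure.pi fun _ : ι => ν) := by
  obtain ⟨hg, hX, e, he, hI⟩ := h
  obtain ⟨hg', hX', e', he', hI'⟩ := h'
  set K := ElementaryIntegrand.integralBound ι with hK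
  have hKtop : K ≠ ⊤ := ENNReal.ofReal_ne_top
  set D := eLpNorm (fun z => g z - g' z) 2 (Measure.pi fun _ : ι => ν)
  have hlim : Tendsto (fun k => eLpNorm (fun ω => (e k).integral Z ω - X ω) 2 P
      + K * (eLpNorm (fun z => (e k).toFun z - g z) 2 (Measure.pi fun _ : ι => ν)
        + (D + eLpNorm (fun z => (e' k).toFun z - g' z) 2 (Measure.pi fun _ : ι => ν)))
      + eLpNorm (fun ω => (e' k).integral Z ω - X' ω) 2 P) atTop
      (𝓝 (0 + K * (0 + (D + 0)) + 0)) :=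
    (hI.add (ENNReal.Tendsto.const_mul (he.add (tendsto_const_nhds.add he'))
      (Or.inr hKtop))).add hI'
  simp only [zero_add, add_zero] at hlim
  refine ge_of_tendsto' hlim fun k => ?_
  have m1 := ((e k).memLp_integral hZ).1
  have m2 := ((e' k).memLp_integral hZ).1
  have m3 := (e k).memLp_toFun.1
  have m4 := (e' k).memLp_toFun.1
  refine (eLpNorm_sub_le_add hX.1 m2 hX'.1).trans (add_le_add_left ?_ _)
  refine (eLpNorm_sub_le_add hX.1 m1 m2).trans
    (add_le_add (eLpNorm_fun_sub_comm _ _).le ?_)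
  refine ((e k).eLpNorm_integral_sub_le hZ (e' k)).trans (mul_le_mul_right ?_ _)
  refine (eLpNorm_sub_le_add m3 hg.1 m4).trans (add_le_add_right ?_ _)
  exact (eLpNorm_sub_le_add hg.1 hg'.1 m4).trans
    (add_le_add_right (eLpNorm_fun_sub_comm _ _).le _)

lemma HasMultipleIntegral.ae_eq (hZ : IsGaussianStochasticMeasure ν P Z)
    {g : (ι → M) → ℝ} {X X' : Ω → ℝ} (h : HasMultipleIntegral ν P Z g X)
    (h' : HasMultipleIntegral ν P Z g X') : X =ᵐ[P] X' := by
  have h0 := h.eLpNorm_sub_le hZ h'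
  simp only [sub_self, eLpNorm_zero', mul_zero, nonpos_iff_eq_zero] at h0
  have h0 := (eLpNorm_eq_zero_iff (h.2.1.1.sub h'.2.1.1) (by simp)).1 h0
  filter_upwards [h0] with ω hω
  exact sub_eq_zero.1 hω

variable [MeasurableSpace.CountablyGenerated M] [MeasurableSpace.SeparatesPoints M]
  [MeasurableEq M] [NullSingletonClass ν]

/-- Existence of the multiple stochastic integral: density of the elementary integrands, the `L²`
bound, and completeness of `L²(P)`. -/
lemma exists_hasMultipleIntegral (hZ : IsGaussianStochasticMeasure ν P Z) {g : (ι → M) → ℝ}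
    (hg : MemLp g 2 (Measure.pi fun _ : ι => ν)) : ∃ X, HasMultipleIntegral ν P Z g X := by
  set K := ElementaryIntegrand.integralBound ι with hK
  have hKtop : K ≠ ⊤ := ENNReal.ofReal_ne_top
  have hdense := elementaryApprox_of_memLp hg
  -- The factor `4` leaves room for the strict inequality in the Cauchy condition.
  let δ : ℕ → ENNReal := fun k => (1 / 2) ^ k / (4 * (K + 1))
  have hδ0 : ∀ k, δ k ≠ 0 := fun k => ENNReal.div_ne_zero.2
    ⟨by simp, ENNReal.mul_ne_top (by simp) (by simp [hKtop])⟩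
  have hcδ : ∀ k, 4 * (K + 1) * δ k = (1 / 2) ^ k := fun k =>
    ENNReal.mul_div_cancel (by simp) (ENNReal.mul_ne_top (by simp) (by simp [hKtop]))
  choose e he using fun k => hdense (δ k) (hδ0 k)
  have hpow : Tendsto (fun k : ℕ => ((1 : ENNReal) / 2) ^ k) atTop (𝓝 0) :=
    ENNReal.tendsto_pow_atTop_nhds_zero_of_lt_one (by simp)
  have hδK : ∀ k, K * (δ k + δ k) ≤ (1 / 2) ^ k / 2 := by
    intro k
    rw [ENNReal.le_div_iff_mul_le (by simp) (by simp), ← hcδ k]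
    calc K * (δ k + δ k) * 2 = 4 * K * δ k := by ring
      _ ≤ 4 * (K + 1) * δ k := by gcongr; exact le_self_add
  have hδle : ∀ k, δ k ≤ (1 / 2) ^ k := fun k => by
    refine ENNReal.div_le_of_le_mul (le_mul_of_one_le_right' ?_)
    calc (1 : ENNReal) ≤ 4 * 1 := by norm_num
      _ ≤ 4 * (K + 1) := by gcongr; exact le_add_self
  have hδanti : ∀ N k, N ≤ k → δ k ≤ δ N := fun N k hk =>
    ENNReal.div_le_div_right (pow_le_pow_right_of_le_one' (by simp) hk) _
  obtain ⟨X, hX, hlim⟩ := Lp.cauchy_complete_eLpNorm (μ := P) (p := 2) (by simp)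
    (f := fun k => (e k).integral Z) (fun k => (e k).memLp_integral hZ)
    (B := fun k => (1 / 2) ^ k) (by simp [ENNReal.tsum_geometric]) (by
      intro N k l hk hl
      have h1 : eLpNorm (fun z => (e k).toFun z - (e l).toFun z) 2 (Measure.pi fun _ : ι => ν)
          ≤ δ N + δ N := by
        refine (eLpNorm_sub_le_add (e k).memLp_toFun.1 hg.1 (e l).memLp_toFun.1).trans
          (add_le_add ((he k).trans (hδanti N k hk)) ?_)
        rw [eLpNorm_fun_sub_comm]
        exact (he l).trans (hδanti N l hl)
      refine (((e k).eLpNorm_integral_sub_le hZ (e l)).trans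
        ((mul_le_mul_right h1 _).trans (hδK N))).trans_lt ?_
      exact ENNReal.half_lt_self (by simp) (ENNReal.pow_ne_top (by simp)))
  exact ⟨X, hg, hX, e, tendsto_of_tendsto_of_tendsto_of_le_of_le tendsto_const_nhds hpow
    (fun _ => zero_le) fun k => (he k).trans (hδle k), hlim⟩

lemma hasMultipleIntegral_iff (hZ : IsGaussianStochasticMeasure ν P Z) {g : (ι → M) → ℝ}
    (hg : MemLp g 2 (Measure.pi fun _ : ι => ν)) (X : Ω → ℝ) :
    HasMultipleIntegral ν P Z g X ↔ X =ᵐ[P] multipleIntegral ν P Z g := by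
  have h := exists_hasMultipleIntegral hZ hg
  have hc : HasMultipleIntegral ν P Z g (multipleIntegral ν P Z g) := by
    unfold multipleIntegral
    rw [dif_pos h]
    exact h.choose_spec
  exact ⟨fun hX => hX.ae_eq hZ hc, fun hX => hc.congr hX⟩

end MultipleIntegral

/-! ### Decay of the Ornstein–Uhlenbeck semigroup -/

section OneParticle

variable {d : ℕ} {μ σ : ℝ}

/-- The weight `exp (c ∑ⱼ |xⱼ|)` on `ℝ^d`. -/
noncomputable def expWeight {d : ℕ} (c : ℝ) (x : EuclideanSpace ℝ (Fin d)) : ℝ :=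
  Real.exp (c * ∑ j, |x j|)

lemma expWeight_pos (c : ℝ) (x : EuclideanSpace ℝ (Fin d)) : 0 < expWeight c x := Real.exp_pos _

lemma continuous_expWeight (c : ℝ) :
    Continuous (expWeight c : EuclideanSpace ℝ (Fin d) → ℝ) := by
  unfold expWeight; fun_prop

lemma expWeight_mul (c c' : ℝ) (x : EuclideanSpace ℝ (Fin d)) :
    expWeight c x * expWeight c' x = expWeight (c + c') x := by
  simp only [expWeight, ← Real.exp_add, add_mul]

lemma expWeight_mono {c c' : ℝ} (h : c ≤ c') (x : EuclideanSpace ℝ (Fin d)) :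
    expWeight c x ≤ expWeight c' x :=
  Real.exp_le_exp.2 (mul_le_mul_of_nonneg_right h (Finset.sum_nonneg fun _ _ => abs_nonneg _))

lemma one_le_expWeight {c : ℝ} (hc : 0 ≤ c) (x : EuclideanSpace ℝ (Fin d)) :
    1 ≤ expWeight c x :=
  Real.one_le_exp (mul_nonneg hc (Finset.sum_nonneg fun _ _ => abs_nonneg _))

lemma norm_le_sum_abs (x : EuclideanSpace ℝ (Fin d)) : ‖x‖ ≤ ∑ j, |x j| := by
  rw [EuclideanSpace.norm_eq]
  refine Real.sqrt_le_iff.2 ⟨Finset.sum_nonneg fun _ _ => abs_nonneg _, ?_⟩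
  simpa using Finset.sum_sq_le_sq_sum_of_nonneg (s := Finset.univ)
    (f := fun j => |x j|) (fun _ _ => abs_nonneg _)

lemma one_add_sq_norm_le (x : EuclideanSpace ℝ (Fin d)) : 1 + ‖x‖ ^ 2 ≤ 2 * expWeight 1 x := by
  have h1 := norm_le_sum_abs x
  have h2 := Real.quadratic_le_exp_of_nonneg (norm_nonneg x)
  have h3 : Real.exp ‖x‖ ≤ expWeight 1 x := Real.exp_le_exp.2 (by simpa using h1)
  nlinarith [norm_nonneg x]

lemma expWeight_smul_add_smul_le {c : ℝ} (hc : 0 ≤ c) {ρ r : ℝ} (hρ0 : 0 ≤ ρ) (hρ1 : ρ ≤ 1)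
    (hr0 : 0 ≤ r) (hr1 : r ≤ 1) (x y : EuclideanSpace ℝ (Fin d)) :
    expWeight c (ρ • x + r • y) ≤ expWeight c x * expWeight c y := by
  simp only [expWeight, ← Real.exp_add, ← mul_add, ← Finset.sum_add_distrib]
  refine Real.exp_le_exp.2 (mul_le_mul_of_nonneg_left (Finset.sum_le_sum fun j _ => ?_) hc)
  simp only [PiLp.add_apply, PiLp.smul_apply, smul_eq_mul]
  refine (abs_add_le _ _).trans (add_le_add ?_ ?_)
  · rw [abs_mul, abs_of_nonneg hρ0]; exact mul_le_of_le_one_left (abs_nonneg _) hρ1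
  · rw [abs_mul, abs_of_nonneg hr0]; exact mul_le_of_le_one_left (abs_nonneg _) hr1

/-- The density of the invariant law. -/
noncomputable def ouDensity (d : ℕ) (μ σ : ℝ) (x : EuclideanSpace ℝ (Fin d)) : ℝ :=
  (μ / (Real.pi * σ ^ 2)) ^ ((d : ℝ) / 2) * Real.exp (-(μ / σ ^ 2) * ‖x‖ ^ 2)

lemma continuous_ouDensity : Continuous (ouDensity d μ σ) := by
  unfold ouDensity; fun_prop

lemma ouDensity_nonneg (hμ : 0 < μ) (x : EuclideanSpace ℝ (Fin d)) : 0 ≤ ouDensity d μ σ x := by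
  unfold ouDensity
  have := Real.pi_pos
  positivity

lemma integrable_ouInvariant_iff (hμ : 0 < μ) {g : EuclideanSpace ℝ (Fin d) → ℝ} :
    Integrable g (ouInvariant d μ σ) ↔ Integrable fun x => ouDensity d μ σ x * g x := by
  unfold ouInvariant
  rw [integrable_withDensity_iff_integrable_smul'
    (by exact (continuous_ouDensity (d := d) (μ := μ) (σ := σ)).measurable.ennreal_ofReal)
    (by simp)]
  refine iff_of_eq (congrArg₂ _ (funext fun x => ?_) rfl)
  rw [smul_eq_mul, ENNReal.toReal_ofReal]
  · rfl
  · exact ouDensity_nonneg hμ x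

lemma integral_ouInvariant (hμ : 0 < μ) (g : EuclideanSpace ℝ (Fin d) → ℝ) :
    ∫ x, g x ∂(ouInvariant d μ σ) = ∫ x, ouDensity d μ σ x * g x := by
  unfold ouInvariant
  rw [integral_withDensity_eq_integral_toReal_smul
    (by exact (continuous_ouDensity (d := d) (μ := μ) (σ := σ)).measurable.ennreal_ofReal)
    (by simp)]
  refine integral_congr_ae (Eventually.of_forall fun x => ?_)
  simp only
  rw [smul_eq_mul, ENNReal.toReal_ofReal]
  · rfl
  · exact ouDensity_nonneg hμ x

lemma integrable_exp_neg_mul_sq_norm {b : ℝ} (hb : 0 < b) :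
    Integrable fun x : EuclideanSpace ℝ (Fin d) => Real.exp (-b * ‖x‖ ^ 2) := by
  have h := GaussianFourier.integrable_cexp_neg_mul_sq_norm_add (b := (b : ℂ)) (by simpa using hb)
    0 (0 : EuclideanSpace ℝ (Fin d))
  refine h.norm.congr (Eventually.of_forall fun x => ?_)
  simp only [zero_mul, add_zero, Complex.norm_exp]
  norm_cast

lemma isProbabilityMeasure_ouInvariant (hμ : 0 < μ) (hσ : 0 < σ) :
    IsProbabilityMeasure (ouInvariant d μ σ) := by
  have hb : 0 < μ / σ ^ 2 := by positivity
  have hi : Integrable (ouDensity d μ σ) := (integrable_exp_neg_mul_sq_norm hb).const_mul _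
  constructor
  unfold ouInvariant
  rw [withDensity_apply _ MeasurableSet.univ, Measure.restrict_univ]
  have h1 := ofReal_integral_eq_lintegral_ofReal hi
    (Eventually.of_forall fun x => ouDensity_nonneg hμ x)
  refine h1.symm.trans ?_
  unfold ouDensity
  rw [integral_const_mul, GaussianFourier.integral_rexp_neg_mul_sq_norm hb,
    finrank_euclideanSpace_fin, ← Real.mul_rpow (by positivity) (by positivity)]
  have : μ / (Real.pi * σ ^ 2) * (Real.pi / (μ / σ ^ 2)) = 1 := by
    have := Real.pi_ne_zero
    field_simp
  rw [this]; simp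

lemma integrable_expWeight (hμ : 0 < μ) (hσ : 0 < σ) {c : ℝ} (hc : 0 ≤ c) :
    Integrable (expWeight c) (ouInvariant d μ σ) := by
  rw [integrable_ouInvariant_iff hμ]
  set a := μ / σ ^ 2 with ha
  have ha0 : 0 < a := by positivity
  set K := (μ / (Real.pi * σ ^ 2)) ^ ((d : ℝ) / 2)
  have hK : 0 ≤ K := by have := Real.pi_pos; positivity
  refine ((integrable_exp_neg_mul_sq_norm (d := d) (half_pos ha0)).const_mul
    (K * Real.exp ((c * Real.sqrt d) ^ 2 / (2 * a)))).mono'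
    (continuous_ouDensity.mul (continuous_expWeight c)).aestronglyMeasurable
    (Eventually.of_forall fun x => ?_)
  rw [Real.norm_of_nonneg (mul_nonneg (ouDensity_nonneg hμ x) (expWeight_pos c x).le)]
  unfold ouDensity expWeight
  rw [mul_assoc, mul_assoc, ← Real.exp_add, ← Real.exp_add]
  refine mul_le_mul_of_nonneg_left (Real.exp_le_exp.2 ?_) hK
  have h1 : ∑ j, |x j| ≤ Real.sqrt d * ‖x‖ := by
    rw [EuclideanSpace.norm_eq, ← Real.sqrt_mul (Nat.cast_nonneg d)]
    refine Real.le_sqrt_of_sq_le ?_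
    have := sq_sum_le_card_mul_sum_sq (s := Finset.univ) (f := fun j => |x j|)
    simpa using this
  have h2 : c * ∑ j, |x j| ≤ (c * Real.sqrt d) * ‖x‖ := by
    rw [mul_assoc]; exact mul_le_mul_of_nonneg_left h1 hc
  -- Completing the square: half of the Gaussian exponent absorbs the exponential growth.
  have h3 : (c * Real.sqrt d) * ‖x‖ ≤ (c * Real.sqrt d) ^ 2 / (2 * a) + a / 2 * ‖x‖ ^ 2 := by
    rw [← sub_nonneg]
    have : (c * Real.sqrt d) ^ 2 / (2 * a) + a / 2 * ‖x‖ ^ 2 - (c * Real.sqrt d) * ‖x‖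
        = (c * Real.sqrt d - a * ‖x‖) ^ 2 / (2 * a) := by field_simp; ring
    rw [this]; positivity
  linarith

/-- The logarithm of the Mehler kernel: `exp` of it is the density of the law of `ρ x + r y`, for
`y` distributed according to the invariant law, with respect to the invariant law. -/
noncomputable def mehlerLog (d : ℕ) (μ σ ρ r : ℝ) (x v : EuclideanSpace ℝ (Fin d)) : ℝ :=
  -(d * Real.log r) + (μ / σ ^ 2) * (‖v‖ ^ 2 - ‖r⁻¹ • (v - ρ • x)‖ ^ 2)

lemma ouDensity_mul_exp_mehlerLog {ρ r : ℝ} (hr : 0 < r) (x v : EuclideanSpace ℝ (Fin d)) :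
    ouDensity d μ σ v * Real.exp (mehlerLog d μ σ ρ r x v)
      = (r ^ d)⁻¹ * ouDensity d μ σ (r⁻¹ • (v - ρ • x)) := by
  have h1 : (r ^ d)⁻¹ = Real.exp (-(d * Real.log r)) := by
    rw [Real.exp_neg, mul_comm, Real.exp_mul, Real.exp_log hr, Real.rpow_natCast]
  rw [h1]
  unfold ouDensity mehlerLog
  rw [mul_assoc, ← Real.exp_add, mul_left_comm, ← Real.exp_add]
  congr 2
  ring

lemma integral_comp_affine_ouInvariant (hμ : 0 < μ) {ρ r : ℝ} (hr : 0 < r)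
    (x : EuclideanSpace ℝ (Fin d)) (g : EuclideanSpace ℝ (Fin d) → ℝ) :
    ∫ y, g (ρ • x + r • y) ∂(ouInvariant d μ σ)
      = ∫ v, g v * Real.exp (mehlerLog d μ σ ρ r x v) ∂(ouInvariant d μ σ) := by
  rw [integral_ouInvariant hμ, integral_ouInvariant hμ]
  let F : EuclideanSpace ℝ (Fin d) → ℝ := fun u => ouDensity d μ σ (r⁻¹ • u) * g (ρ • x + u)
  have h1 := Measure.integral_comp_smul volume F r
  have h2 : (fun y => F (r • y)) = fun y => ouDensity d μ σ y * g (ρ • x + r • y) := by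
    ext y; simp only [F, smul_smul, inv_mul_cancel₀ hr.ne', one_smul]
  rw [h2] at h1
  rw [h1, finrank_euclideanSpace_fin, abs_of_pos (by positivity), smul_eq_mul,
    ← integral_const_mul, ← integral_add_left_eq_self _ (-(ρ • x))]
  refine integral_congr_ae (Eventually.of_forall fun v => ?_)
  have h3 := ouDensity_mul_exp_mehlerLog (d := d) (μ := μ) (σ := σ) (ρ := ρ) hr x v
  have h4 : -(ρ • x) + v = v - ρ • x := by abel
  have h5 : ρ • x + (v - ρ • x) = v := by abel
  simp only [F, h4, h5]
  rw [mul_left_comm (ouDensity d μ σ v), h3]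
  ring

lemma integrable_mul_exp_mehlerLog (hμ : 0 < μ) {ρ r : ℝ} (hr : 0 < r)
    (x : EuclideanSpace ℝ (Fin d)) {g : EuclideanSpace ℝ (Fin d) → ℝ}
    (hg : Integrable (fun y => g (ρ • x + r • y)) (ouInvariant d μ σ)) :
    Integrable (fun v => g v * Real.exp (mehlerLog d μ σ ρ r x v)) (ouInvariant d μ σ) := by
  rw [integrable_ouInvariant_iff hμ] at hg ⊢
  let F : EuclideanSpace ℝ (Fin d) → ℝ := fun u => ouDensity d μ σ (r⁻¹ • u) * g (ρ • x + u)
  have h2 : (fun y => F (r • y)) = fun y => ouDensity d μ σ y * g (ρ • x + r • y) := by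
    ext y; simp only [F, smul_smul, inv_mul_cancel₀ hr.ne', one_smul]
  rw [← h2, integrable_comp_smul_iff _ _ hr.ne'] at hg
  refine ((hg.comp_add_left (-(ρ • x))).const_mul (r ^ d)⁻¹).congr
    (Eventually.of_forall fun v => ?_)
  have h3 := ouDensity_mul_exp_mehlerLog (d := d) (μ := μ) (σ := σ) (ρ := ρ) hr x v
  have h4 : -(ρ • x) + v = v - ρ • x := by abel
  have h5 : ρ • x + (v - ρ • x) = v := by abel
  simp only [F, h4, h5]
  rw [mul_left_comm (ouDensity d μ σ v), h3]
  ring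

/-- The logarithm of the Mehler kernel is of order `ρ`, up to polynomial factors. -/
lemma abs_mehlerLog_le (hμ : 0 < μ) (hσ : 0 < σ) {ρ r : ℝ} (hρ0 : 0 ≤ ρ) (hρ : ρ ≤ 1 / 2)
    (hr : 0 < r) (hρr : ρ ^ 2 + r ^ 2 = 1) (x v : EuclideanSpace ℝ (Fin d)) :
    |mehlerLog d μ σ ρ r x v|
      ≤ ρ * (d + 4 * (μ / σ ^ 2)) * ((1 + ‖x‖ ^ 2) * (1 + ‖v‖ ^ 2)) := by
  set a := μ / σ ^ 2 with ha
  have ha0 : 0 < a := by positivity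
  have hr2 : 3 / 4 ≤ r ^ 2 := by nlinarith
  have hr1 : r ≤ 1 := by nlinarith
  have hlog : |Real.log r| ≤ ρ := by
    have h1 := Real.log_le_sub_one_of_pos (x := (r ^ 2)⁻¹) (by positivity)
    rw [Real.log_inv, Real.log_pow] at h1
    have h2 : (r ^ 2)⁻¹ - 1 ≤ 2 * ρ := by
      have : (r ^ 2)⁻¹ ≤ 1 + 2 * ρ := by
        rw [inv_le_iff_one_le_mul₀ (by positivity)]
        nlinarith
      linarith
    rw [abs_of_nonpos (Real.log_nonpos hr.le hr1)]
    push_cast at h1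
    linarith
  have hP : 1 ≤ (1 + ‖x‖ ^ 2) * (1 + ‖v‖ ^ 2) := by
    nlinarith [sq_nonneg ‖x‖, sq_nonneg ‖v‖, mul_nonneg (sq_nonneg ‖x‖) (sq_nonneg ‖v‖)]
  have hquad : ‖v‖ ^ 2 - ‖r⁻¹ • (v - ρ • x)‖ ^ 2
      = (r ^ 2)⁻¹ * (-(ρ ^ 2 * ‖v‖ ^ 2) + 2 * (ρ * inner ℝ v x) - ρ ^ 2 * ‖x‖ ^ 2) := by
    rw [norm_smul, mul_pow, norm_sub_sq_real, inner_smul_right, norm_smul, norm_inv, mul_pow,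
      inv_pow, Real.norm_eq_abs, Real.norm_eq_abs, sq_abs, sq_abs]
    have : r ^ 2 ≠ 0 := by positivity
    field_simp
    have : r ^ 2 = 1 - ρ ^ 2 := by linarith
    rw [this]; ring
  have hinner : |inner ℝ v x| ≤ (‖v‖ ^ 2 + ‖x‖ ^ 2) / 2 := by
    refine (abs_real_inner_le_norm v x).trans ?_
    nlinarith [sq_nonneg (‖v‖ - ‖x‖)]
  have hQ : |-(ρ ^ 2 * ‖v‖ ^ 2) + 2 * (ρ * inner ℝ v x) - ρ ^ 2 * ‖x‖ ^ 2|
      ≤ 2 * ρ * (‖v‖ ^ 2 + ‖x‖ ^ 2) := by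
    obtain ⟨h1, h2⟩ := abs_le.1 hinner
    have hρ2 : ρ ^ 2 ≤ ρ := by nlinarith
    have h3 := mul_le_mul_of_nonneg_left h2 hρ0
    have h4 := mul_le_mul_of_nonneg_left h1 hρ0
    have h5 := mul_le_mul_of_nonneg_right hρ2 (sq_nonneg ‖v‖)
    have h6 := mul_le_mul_of_nonneg_right hρ2 (sq_nonneg ‖x‖)
    have h7 := mul_nonneg (sq_nonneg ρ) (sq_nonneg ‖v‖)
    have h8 := mul_nonneg (sq_nonneg ρ) (sq_nonneg ‖x‖)
    rw [abs_le]
    constructor <;> nlinarith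
  have hinv : (r ^ 2)⁻¹ ≤ 2 := by
    rw [inv_le_iff_one_le_mul₀ (by positivity)]; linarith
  have hsum : ‖v‖ ^ 2 + ‖x‖ ^ 2 ≤ (1 + ‖x‖ ^ 2) * (1 + ‖v‖ ^ 2) := by
    nlinarith [mul_nonneg (sq_nonneg ‖x‖) (sq_nonneg ‖v‖)]
  unfold mehlerLog
  rw [hquad]
  have e1 : |-(d * Real.log r)| ≤ d * ρ * ((1 + ‖x‖ ^ 2) * (1 + ‖v‖ ^ 2)) := by
    rw [abs_neg, abs_mul, Nat.abs_cast]
    exact (mul_le_mul_of_nonneg_left hlog (Nat.cast_nonneg d)).trans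
      (le_mul_of_one_le_right (by positivity) hP)
  have e2 : |a * ((r ^ 2)⁻¹ * (-(ρ ^ 2 * ‖v‖ ^ 2) + 2 * (ρ * inner ℝ v x) - ρ ^ 2 * ‖x‖ ^ 2))|
      ≤ a * (2 * (2 * ρ * ((1 + ‖x‖ ^ 2) * (1 + ‖v‖ ^ 2)))) := by
    rw [abs_mul, abs_mul, abs_of_pos ha0, abs_of_pos (by positivity : 0 < (r ^ 2)⁻¹)]
    gcongr
    exact hQ.trans (by gcongr)
  refine (abs_add_le _ _).trans ((add_le_add e1 e2).trans_eq ?_)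
  ring

lemma abs_exp_sub_one_le (t : ℝ) : |Real.exp t - 1| ≤ |t| * (Real.exp t + 1) := by
  have h1 := Real.add_one_le_exp t
  have h2 := Real.add_one_le_exp (-t)
  have h3 : Real.exp t * Real.exp (-t) = 1 := by rw [← Real.exp_add]; simp
  have h4 := Real.exp_pos t
  rcases le_total 0 t with ht | ht
  · rw [abs_of_nonneg ht, abs_of_nonneg (by linarith)]; nlinarith
  · rw [abs_of_nonpos ht, abs_of_nonpos (by linarith [Real.exp_le_one_iff.2 ht])]; nlinarith

/-- The constant in the decay estimate for the Ornstein–Uhlenbeck semigroup: the first summand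
serves the times with `e^{-μ s} > 1/2`, the second one the other times. -/
noncomputable def decayConst (d : ℕ) (μ σ : ℝ) : ℝ :=
  2 * ∫ y, expWeight 1 y ∂(ouInvariant d μ σ)
    + 8 * (d + 4 * (μ / σ ^ 2)) * ∫ y, expWeight 2 y ∂(ouInvariant d μ σ)

lemma integral_expWeight_nonneg (c : ℝ) : 0 ≤ ∫ y, expWeight c y ∂(ouInvariant d μ σ) :=
  integral_nonneg fun y => (expWeight_pos c y).le

lemma decayConst_nonneg (hμ : 0 < μ) : 0 ≤ decayConst d μ σ := by
  have h1 := integral_expWeight_nonneg (d := d) (μ := μ) (σ := σ) 1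
  have h2 := integral_expWeight_nonneg (d := d) (μ := μ) (σ := σ) 2
  unfold decayConst
  positivity

lemma integrable_expWeight_comp_affine (hμ : 0 < μ) (hσ : 0 < σ) {c : ℝ} (hc : 0 ≤ c) {ρ r : ℝ}
    (hρ0 : 0 ≤ ρ) (hρ1 : ρ ≤ 1) (hr0 : 0 ≤ r) (hr1 : r ≤ 1) (x : EuclideanSpace ℝ (Fin d)) :
    Integrable (fun y => expWeight c (ρ • x + r • y)) (ouInvariant d μ σ) := by
  refine ((integrable_expWeight hμ hσ hc).const_mul (expWeight c x)).mono'
    (Continuous.aestronglyMeasurable ?_) (Eventually.of_forall fun y => ?_)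
  · exact (continuous_expWeight c).comp (by fun_prop)
  · rw [Real.norm_of_nonneg (expWeight_pos _ _).le]
    exact expWeight_smul_add_smul_le hc hρ0 hρ1 hr0 hr1 x y

lemma integral_expWeight_comp_affine_le (hμ : 0 < μ) (hσ : 0 < σ) {c : ℝ} (hc : 0 ≤ c) {ρ r : ℝ}
    (hρ0 : 0 ≤ ρ) (hρ1 : ρ ≤ 1) (hr0 : 0 ≤ r) (hr1 : r ≤ 1) (x : EuclideanSpace ℝ (Fin d)) :
    ∫ y, expWeight c (ρ • x + r • y) ∂(ouInvariant d μ σ)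
      ≤ expWeight c x * ∫ y, expWeight c y ∂(ouInvariant d μ σ) := by
  rw [← integral_const_mul]
  exact integral_mono (integrable_expWeight_comp_affine hμ hσ hc hρ0 hρ1 hr0 hr1 x)
    ((integrable_expWeight hμ hσ hc).const_mul _)
    fun y => expWeight_smul_add_smul_le hc hρ0 hρ1 hr0 hr1 x y

/-- A function of mean zero decays like `ρ = e^{-μ s}` under the Ornstein–Uhlenbeck semigroup. For
small `ρ` the Mehler kernel is compared with the constant `1`, against which the function integrates
to zero; for `ρ` bounded below there is nothing to gain and the growth bound suffices. -/
theorem abs_integral_comp_affine_le (hμ : 0 < μ) (hσ : 0 < σ) {ρ r : ℝ} (hρ0 : 0 ≤ ρ)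
    (hr0 : 0 ≤ r) (hρr : ρ ^ 2 + r ^ 2 = 1) (x : EuclideanSpace ℝ (Fin d))
    {g : EuclideanSpace ℝ (Fin d) → ℝ} (hg : Measurable g) {C : ℝ}
    (hgC : ∀ y, |g y| ≤ C * expWeight 1 y) (hg0 : ∫ y, g y ∂(ouInvariant d μ σ) = 0) :
    |∫ y, g (ρ • x + r • y) ∂(ouInvariant d μ σ)|
      ≤ C * (decayConst d μ σ * ρ * expWeight 3 x) := by
  have := isProbabilityMeasure_ouInvariant (d := d) hμ hσ
  have hC : 0 ≤ C := by
    have := (abs_nonneg _).trans (hgC 0)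
    exact nonneg_of_mul_nonneg_left this (expWeight_pos 1 0)
  have hρ1 : ρ ≤ 1 := by nlinarith
  have hr1 : r ≤ 1 := by nlinarith
  set I1 := ∫ y, expWeight 1 y ∂(ouInvariant d μ σ) with hI1
  set I2 := ∫ y, expWeight 2 y ∂(ouInvariant d μ σ) with hI2
  have hI1' : 0 ≤ I1 := integral_expWeight_nonneg 1
  have hI2' : 0 ≤ I2 := integral_expWeight_nonneg 2
  set K := (d : ℝ) + 4 * (μ / σ ^ 2) with hK
  have hK0 : 0 ≤ K := by positivity
  have hdecay : decayConst d μ σ = 2 * I1 + 8 * K * I2 := rfl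
  rcases le_or_gt ρ (1 / 2) with hρ | hρ
  · have hr : 0 < r := by
      rcases hr0.lt_or_eq with h | h
      · exact h
      · rw [← h] at hρr; nlinarith
    have i2 : Integrable (fun v => expWeight 2 v * Real.exp (mehlerLog d μ σ ρ r x v))
        (ouInvariant d μ σ) := integrable_mul_exp_mehlerLog hμ hr x
      (integrable_expWeight_comp_affine hμ hσ (by norm_num) hρ0 hρ1 hr0 hr1 x)
    have i3 := integrable_expWeight (d := d) hμ hσ (c := 2) (by norm_num)
    have ig : Integrable g (ouInvariant d μ σ) :=
      ((integrable_expWeight hμ hσ zero_le_one).const_mul C).mono' hg.aestronglyMeasurable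
        (Eventually.of_forall hgC)
    have igM : Integrable (fun v => g v * Real.exp (mehlerLog d μ σ ρ r x v))
        (ouInvariant d μ σ) := by
      refine integrable_mul_exp_mehlerLog hμ hr x
        (((integrable_expWeight_comp_affine hμ hσ zero_le_one hρ0 hρ1 hr0 hr1 x).const_mul C).mono'
        (hg.comp (by fun_prop)).aestronglyMeasurable (Eventually.of_forall fun y => hgC _))
    have hM : ∫ v, expWeight 2 v * Real.exp (mehlerLog d μ σ ρ r x v) ∂(ouInvariant d μ σ)
        ≤ expWeight 2 x * I2 := by
      rw [← integral_comp_affine_ouInvariant hμ hr x (expWeight 2)]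
      exact integral_expWeight_comp_affine_le hμ hσ (by norm_num) hρ0 hρ1 hr0 hr1 x
    have hpt : ∀ v, ‖g v * Real.exp (mehlerLog d μ σ ρ r x v) - g v‖ ≤
        (C * ρ * K * 4 * expWeight 1 x) *
          (expWeight 2 v * Real.exp (mehlerLog d μ σ ρ r x v) + expWeight 2 v) := by
      intro v
      have e1 : g v * Real.exp (mehlerLog d μ σ ρ r x v) - g v
          = g v * (Real.exp (mehlerLog d μ σ ρ r x v) - 1) := by ring
      rw [e1, Real.norm_eq_abs, abs_mul]
      have e2 := abs_exp_sub_one_le (mehlerLog d μ σ ρ r x v)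
      have e3 := abs_mehlerLog_le hμ hσ hρ0 hρ hr hρr x v
      have e4 : (1 + ‖x‖ ^ 2) * (1 + ‖v‖ ^ 2) ≤ (2 * expWeight 1 x) * (2 * expWeight 1 v) :=
        mul_le_mul (one_add_sq_norm_le x) (one_add_sq_norm_le v) (by positivity)
          (by have := expWeight_pos 1 x; positivity)
      have e5 : expWeight 2 v = expWeight 1 v * expWeight 1 v := by
        rw [expWeight_mul]; norm_num
      have hM0 := Real.exp_pos (mehlerLog d μ σ ρ r x v)
      calc |g v| * |Real.exp (mehlerLog d μ σ ρ r x v) - 1|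
          ≤ (C * expWeight 1 v) * ((ρ * K * ((2 * expWeight 1 x) * (2 * expWeight 1 v)))
            * (Real.exp (mehlerLog d μ σ ρ r x v) + 1)) := by
            refine mul_le_mul (hgC v) (e2.trans ?_) (abs_nonneg _)
              (mul_nonneg hC (expWeight_pos 1 v).le)
            refine mul_le_mul_of_nonneg_right (e3.trans ?_) (by positivity)
            exact mul_le_mul_of_nonneg_left e4 (by positivity)
        _ = _ := by rw [e5]; ring
    rw [integral_comp_affine_ouInvariant hμ hr x g]
    -- Subtracting the constant `1` from the Mehler kernel is free, because `g` has mean zero.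
    have e6 : ∫ v, g v * Real.exp (mehlerLog d μ σ ρ r x v) ∂(ouInvariant d μ σ)
        = ∫ v, (g v * Real.exp (mehlerLog d μ σ ρ r x v) - g v) ∂(ouInvariant d μ σ) := by
      rw [integral_sub igM ig, hg0, sub_zero]
    rw [e6]
    have e7 := norm_integral_le_of_norm_le ((i2.add i3).const_mul
      (C * ρ * K * 4 * expWeight 1 x)) (Eventually.of_forall hpt)
    rw [Real.norm_eq_abs] at e7
    refine e7.trans ?_
    simp only [Pi.add_apply]
    rw [integral_const_mul, integral_add i2 i3]
    have e8 : expWeight 3 x = expWeight 1 x * expWeight 2 x := by rw [expWeight_mul]; norm_num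
    have hx1 := expWeight_pos 1 x
    have hx2 : 1 ≤ expWeight 2 x := one_le_expWeight (by norm_num) x
    calc C * ρ * K * 4 * expWeight 1 x *
          ((∫ v, expWeight 2 v * Real.exp (mehlerLog d μ σ ρ r x v) ∂(ouInvariant d μ σ)) + I2)
        ≤ C * ρ * K * 4 * expWeight 1 x * (expWeight 2 x * I2 + expWeight 2 x * I2) := by
          gcongr
          exact le_mul_of_one_le_left hI2' hx2
      _ = C * ((8 * K * I2) * ρ * expWeight 3 x) := by rw [e8]; ring
      _ ≤ C * (decayConst d μ σ * ρ * expWeight 3 x) := by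
          have := expWeight_pos 3 x
          rw [hdecay]
          gcongr
          linarith
  · have e1 := norm_integral_le_of_norm_le (f := fun y => g (ρ • x + r • y))
      ((integrable_expWeight_comp_affine hμ hσ zero_le_one hρ0 hρ1 hr0 hr1 x).const_mul C)
      (Eventually.of_forall fun y => hgC (ρ • x + r • y))
    rw [Real.norm_eq_abs] at e1
    refine e1.trans ?_
    rw [integral_const_mul]
    refine mul_le_mul_of_nonneg_left ?_ hC
    refine (integral_expWeight_comp_affine_le hμ hσ zero_le_one hρ0 hρ1 hr0 hr1 x).trans ?_
    have e2 : expWeight 1 x ≤ expWeight 3 x := expWeight_mono (by norm_num) x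
    have e3 := expWeight_pos 3 x
    have e4 : 0 ≤ 8 * K * I2 := by positivity
    have e5 : I1 ≤ decayConst d μ σ * ρ := by
      rw [hdecay]
      nlinarith [mul_nonneg e4 hρ0]
    calc expWeight 1 x * I1 ≤ expWeight 3 x * (decayConst d μ σ * ρ) := by
          gcongr
      _ = _ := by ring

end OneParticle

/-! ### Canonical kernels under the tensor power of the semigroup -/

section Tensor

/-- Tensorization of a bound for functions of mean zero: if each `κ i` maps the functions of mean
zero dominated by `W` into `[-b i, b i]`, then the product of the `κ i` maps the canonical functions
dominated by `∏ W` into `[-∏ b i, ∏ b i]`. The coordinates are integrated out one by one; the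
partial integrals stay canonical in the remaining coordinates, by Fubini. -/
theorem abs_integral_pi_le_of_canonical {E : Type*} [MeasurableSpace E] {φ : Measure E}
    [IsProbabilityMeasure φ] {W : E → ℝ} (hWφ : Integrable W φ) :
    ∀ {n : ℕ} {κ : Fin n → Measure E} [∀ i, IsProbabilityMeasure (κ i)] {b : Fin n → ℝ}
      (_ : ∀ i, Integrable W (κ i))
      (_ : ∀ i (g : E → ℝ) (C : ℝ), Measurable g → (∀ y, |g y| ≤ C * W y) → ∫ y, g y ∂φ = 0 →
        |∫ y, g y ∂(κ i)| ≤ C * b i)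
      {f : (Fin n → E) → ℝ} {C : ℝ} (_ : Measurable f) (_ : ∀ x, |f x| ≤ C * ∏ i, W (x i))
      (_ : ∀ k x, ∫ y, f (Function.update x k y) ∂φ = 0),
      |∫ x, f x ∂(Measure.pi κ)| ≤ C * ∏ i, b i := by
  intro n
  induction n with
  | zero =>
    intro κ _ b _ _ f C _ hfC _
    rw [Measure.pi_of_empty κ, integral_dirac]
    simpa using hfC _
  | succ n ih =>
    intro κ _ b hWκ hκ f C hf hfC hf0
    have hcons : Measurable fun p : E × (Fin n → E) => (Fin.cons p.1 p.2 : Fin (n + 1) → E) := by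
      refine measurable_pi_iff.2 fun i => ?_
      refine Fin.cases ?_ (fun j => ?_) i
      · simpa using measurable_fst
      · simp only [Fin.cons_succ]; fun_prop
    have hfm : Measurable fun p : E × (Fin n → E) => f (Fin.cons p.1 p.2) := hf.comp hcons
    have hbound : ∀ y x', |f (Fin.cons y x')| ≤ (C * ∏ i, W (x' i)) * W y := by
      intro y x'
      refine (hfC _).trans_eq ?_
      rw [Fin.prod_univ_succ]
      simp only [Fin.cons_zero, Fin.cons_succ]
      ring
    let g : (Fin n → E) → ℝ := fun x' => ∫ y, f (Fin.cons y x') ∂(κ 0)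
    have hg : Measurable g := by
      have h : StronglyMeasurable (Function.uncurry fun (x' : Fin n → E) (y : E) =>
          f (Fin.cons y x')) := (hfm.comp measurable_swap).stronglyMeasurable
      exact h.integral_prod_right.measurable
    have hupd : ∀ (y y' : E) (x' : Fin n → E),
        Function.update (Fin.cons y x' : Fin (n + 1) → E) 0 y' = Fin.cons y' x' := by
      intro y y' x'; rw [Fin.update_cons_zero]
    obtain ⟨y0⟩ : Nonempty E := φ.nonempty_of_neZero
    have hgC : ∀ x', |g x'| ≤ (C * b 0) * ∏ i, W (x' i) := by
      intro x'
      refine (hκ 0 (fun y => f (Fin.cons y x')) _ (hfm.comp (measurable_id.prodMk measurable_const))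
        (fun y => hbound y x')
        ?_).trans_eq (by ring)
      have := hf0 0 (Fin.cons y0 x')
      simp_rw [hupd] at this
      exact this
    have hg0 : ∀ k x', ∫ y, g (Function.update x' k y) ∂φ = 0 := by
      intro k x'
      have hint : Integrable (Function.uncurry fun (v y : E) =>
          f (Fin.cons y (Function.update x' k v))) (φ.prod (κ 0)) := by
        have h1 : Integrable (fun p : E × E =>
            (C * ∏ i ∈ Finset.univ.erase k, W (x' i)) * (W p.1 * W p.2)) (φ.prod (κ 0)) :=
          (hWφ.mul_prod (hWκ 0)).const_mul _
        refine h1.mono' ?_ (Eventually.of_forall fun p => ?_)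
        · refine (hfm.comp (?_ : Measurable fun p : E × E =>
            (p.2, Function.update x' k p.1))).aestronglyMeasurable
          exact measurable_snd.prodMk ((measurable_update x').comp measurable_fst)
        · refine (hbound p.2 _).trans_eq ?_
          rw [← Finset.mul_prod_erase Finset.univ _ (Finset.mem_univ k), Function.update_self]
          rw [Finset.prod_congr rfl fun i hi => by
            rw [Function.update_of_ne (Finset.ne_of_mem_erase hi)]]
          ring
      change ∫ v, ∫ y, f (Fin.cons y (Function.update x' k v)) ∂(κ 0) ∂φ = 0
      rw [integral_integral_swap hint]
      refine integral_eq_zero_of_ae (Eventually.of_forall fun y => ?_)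
      have := hf0 k.succ (Fin.cons y x')
      simp_rw [← Fin.cons_update] at this
      exact this
    have hmain := ih (κ := fun i => κ i.succ) (b := fun i => b i.succ) (fun i => hWκ _)
      (fun i => hκ _) hg hgC hg0
    have hfint : Integrable f (Measure.pi κ) := by
      refine ((Integrable.fintype_prod (f := fun _ => W) hWκ).const_mul C).mono'
        hf.aestronglyMeasurable (Eventually.of_forall hfC)
    have hmp := (measurePreserving_piFinSuccAbove κ 0).symm
    have heq : ∫ x, f x ∂(Measure.pi κ) = ∫ x', g x' ∂(Measure.pi fun i => κ i.succ) := by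
      have h1 := hmp.integral_comp' f
      have h2 : Integrable (fun p => f ((MeasurableEquiv.piFinSuccAbove (fun _ => E) 0).symm p))
          ((κ 0).prod (Measure.pi fun i => κ i.succ)) :=
        hmp.integrable_comp_of_integrable hfint
      rw [← h1]
      refine (integral_prod_symm _ h2).trans ?_
      refine integral_congr_ae (Eventually.of_forall fun x' => ?_)
      refine integral_congr_ae (Eventually.of_forall fun y => ?_)
      simp [MeasurableEquiv.piFinSuccAbove_symm_apply]
      rfl
    rw [heq]
    refine hmain.trans_eq ?_
    rw [Fin.prod_univ_succ]; ring

variable {n d : ℕ} {μ σ : ℝ}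

/-- The decaying bound `K e^{-μ s} exp (3 ∑ⱼ |xⱼ|)` contributed by one particle `(s, x)`. -/
noncomputable def siteBound {d : ℕ} (μ σ : ℝ) (p : TimeSpace d) : ℝ :=
  decayConst d μ σ * Real.exp (-μ * p.1) * expWeight 3 p.2

lemma continuous_siteBound : Continuous (siteBound μ σ : TimeSpace d → ℝ) := by
  unfold siteBound
  have := continuous_expWeight (d := d) 3
  fun_prop

lemma exp_two_mul_le_one (hμ : 0 < μ) {s : ℝ} (hs : 0 ≤ s) : Real.exp (-2 * μ * s) ≤ 1 :=
  Real.exp_le_one_iff.2 (by nlinarith [mul_nonneg hμ.le hs])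

lemma sq_exp_add_sq_sqrt (hμ : 0 < μ) {s : ℝ} (hs : 0 ≤ s) :
    Real.exp (-μ * s) ^ 2 + Real.sqrt (1 - Real.exp (-2 * μ * s)) ^ 2 = 1 := by
  rw [Real.sq_sqrt (sub_nonneg.2 (exp_two_mul_le_one hμ hs)), ← Real.exp_nat_mul]
  have : ((2 : ℕ) : ℝ) * (-μ * s) = -2 * μ * s := by push_cast; ring
  rw [this]; ring

/-- The decay of `H(f)` for a canonical kernel `f`. -/
theorem abs_ouTensor_le (hμ : 0 < μ) (hσ : 0 < σ) {f : Config n d → ℝ} (hf : Continuous f) {C : ℝ}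
    (hfC : ∀ x, |f x| ≤ C * ∏ i, expWeight 1 (x i)) (hcan : IsCanonical μ σ f)
    {z : Fin n → TimeSpace d} (hz : ∀ i, 0 ≤ (z i).1) :
    |ouTensor μ σ f z| ≤ C * ∏ i, siteBound μ σ (z i) := by
  have := isProbabilityMeasure_ouInvariant (d := d) hμ hσ
  let T : Fin n → EuclideanSpace ℝ (Fin d) → EuclideanSpace ℝ (Fin d) := fun i y =>
    Real.exp (-μ * (z i).1) • (z i).2 + Real.sqrt (1 - Real.exp (-2 * μ * (z i).1)) • y
  have hT : ∀ i, Measurable (T i) := fun i => by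
    have : Continuous (T i) := by fun_prop
    exact this.measurable
  have hprob : ∀ i, IsProbabilityMeasure ((ouInvariant d μ σ).map (T i)) := fun i =>
    Measure.isProbabilityMeasure_map (hT i).aemeasurable
  have hsq := fun i => sq_exp_add_sq_sqrt hμ (hz i)
  have hρ0 := fun i => (Real.exp_pos (-μ * (z i).1)).le
  have hr0 := fun i => Real.sqrt_nonneg (1 - Real.exp (-2 * μ * (z i).1))
  have heq : ouTensor μ σ f z
      = ∫ x, f x ∂(Measure.pi fun i => (ouInvariant d μ σ).map (T i)) := by
    rw [← Measure.pi_map_pi fun i => (hT i).aemeasurable, integral_map]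
    · rfl
    · exact (measurable_pi_lambda _ fun i => (hT i).comp (measurable_pi_apply i)).aemeasurable
    · exact hf.aestronglyMeasurable
  rw [heq]
  refine abs_integral_pi_le_of_canonical (φ := ouInvariant d μ σ) (W := expWeight 1)
    (integrable_expWeight hμ hσ zero_le_one) (fun i => ?_)
    (fun i g C hg hgC hg0 => ?_) hf.measurable hfC hcan
  · rw [integrable_map_measure (continuous_expWeight 1).aestronglyMeasurable (hT i).aemeasurable]
    exact integrable_expWeight_comp_affine hμ hσ zero_le_one (hρ0 i)
      (by nlinarith [hsq i, hρ0 i, hr0 i]) (hr0 i) (by nlinarith [hsq i, hρ0 i, hr0 i]) _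
  · rw [integral_map (hT i).aemeasurable hg.aestronglyMeasurable]
    exact abs_integral_comp_affine_le hμ hσ (hρ0 i) (hr0 i) (hsq i) _ hg hgC hg0

lemma PSpace.abs_toFun_le (f : PSpace n d) (x : Config n d) :
    |f.toFun x| ≤ ‖f‖ * ∏ i, expWeight 1 (x i) := by
  have h : |configWeight x * f.toFun x| ≤ ‖f‖ := le_ciSup (IsPolyGrowth.bddAbove f.2) x
  have hw : configWeight x * ∏ i, expWeight 1 (x i) = 1 := by
    simp only [configWeight, expWeight, ← Real.exp_sum, ← Real.exp_add, one_mul]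
    simp
  have hpos : 0 < ∏ i, expWeight 1 (x i) := Finset.prod_pos fun i _ => expWeight_pos 1 _
  calc |f.toFun x| = |configWeight x * f.toFun x| * ∏ i, expWeight 1 (x i) := by
        have hpos' : 0 < configWeight x := Real.exp_pos _
        rw [abs_mul, abs_of_pos hpos', mul_right_comm, hw, one_mul]
    _ ≤ _ := mul_le_mul_of_nonneg_right h hpos.le

lemma PSpace.continuous_toFun (f : PSpace n d) : Continuous f.toFun := f.2.1

lemma stronglyMeasurable_ouTensor (hμ : 0 < μ) (hσ : 0 < σ) {f : Config n d → ℝ}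
    (hf : Continuous f) : StronglyMeasurable (ouTensor μ σ f) := by
  have := isProbabilityMeasure_ouInvariant (d := d) hμ hσ
  have h : Continuous (Function.uncurry fun (z : Fin n → TimeSpace d) (y : Config n d) =>
      f (fun i => Real.exp (-μ * (z i).1) • (z i).2
        + Real.sqrt (1 - Real.exp (-2 * μ * (z i).1)) • y i)) := by
    refine hf.comp ?_
    fun_prop
  exact h.stronglyMeasurable.integral_prod_right

lemma ouTensor_sub (hμ : 0 < μ) (hσ : 0 < σ) (f g : PSpace n d) {z : Fin n → TimeSpace d}
    (hz : ∀ i, 0 ≤ (z i).1) :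
    ouTensor μ σ (f - g).toFun z = ouTensor μ σ f.toFun z - ouTensor μ σ g.toFun z := by
  have := isProbabilityMeasure_ouInvariant (d := d) hμ hσ
  have hint : ∀ f : PSpace n d, Integrable (fun y : Config n d =>
      f.toFun (fun i => Real.exp (-μ * (z i).1) • (z i).2
        + Real.sqrt (1 - Real.exp (-2 * μ * (z i).1)) • y i))
      (Measure.pi fun _ => ouInvariant d μ σ) := by
    intro f
    have hsq := fun i => sq_exp_add_sq_sqrt hμ (hz i)
    have hρ0 := fun i => (Real.exp_pos (-μ * (z i).1)).le
    have hr0 := fun i => Real.sqrt_nonneg (1 - Real.exp (-2 * μ * (z i).1))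
    have h1 := fun i => integrable_expWeight_comp_affine (d := d) hμ hσ zero_le_one (hρ0 i)
      (by nlinarith [hsq i, hρ0 i, hr0 i]) (hr0 i) (by nlinarith [hsq i, hρ0 i, hr0 i]) (z i).2
    refine ((Integrable.fintype_prod_dep h1).const_mul ‖f‖).mono' ?_
      (Eventually.of_forall fun y => f.abs_toFun_le _)
    refine Continuous.aestronglyMeasurable (f.continuous_toFun.comp ?_)
    fun_prop
  exact integral_sub (hint f) (hint g)

lemma isCanonical_sub (hμ : 0 < μ) (hσ : 0 < σ) {f g : PSpace n d} (hf : IsCanonical μ σ f.toFun)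
    (hg : IsCanonical μ σ g.toFun) : IsCanonical μ σ (f - g).toFun := by
  intro k x
  have hint : ∀ f : PSpace n d, Integrable (fun y => f.toFun (Function.update x k y))
      (ouInvariant d μ σ) := by
    intro f
    refine ((integrable_expWeight hμ hσ zero_le_one).const_mul
      (‖f‖ * ∏ i ∈ Finset.univ.erase k, expWeight 1 (x i))).mono' ?_
      (Eventually.of_forall fun y => ?_)
    · refine Continuous.aestronglyMeasurable (f.continuous_toFun.comp ?_)
      exact continuous_const.update k continuous_id
    · refine (f.abs_toFun_le _).trans_eq ?_
      rw [← Finset.mul_prod_erase Finset.univ _ (Finset.mem_univ k), Function.update_self]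
      rw [Finset.prod_congr rfl fun i hi => by
        rw [Function.update_of_ne (Finset.ne_of_mem_erase hi)]]
      ring
  have h := integral_sub (hint f) (hint g)
  rw [hf k x, hg k x, sub_zero] at h
  exact h

end Tensor

/-! ### Feynman diagrams and their kernels -/

namespace FeynmanDiagram

variable {n : ℕ} {M : Type*}

/-- A paired vertex. -/
abbrev Paired (γ : FeynmanDiagram n) : Type := {i : Fin n // ¬ ∀ j, ¬ γ.graph.Adj i j}

lemma Paired.exists_adj {γ : FeynmanDiagram n} (i : γ.Paired) : ∃ j, γ.graph.Adj i j := by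
  simpa using i.2

/-- The edge at a paired vertex. -/
noncomputable def edgeAt (γ : FeynmanDiagram n) (i : γ.Paired) : γ.Edge :=
  ⟨s(i.1, i.exists_adj.choose), (SimpleGraph.mem_edgeSet _).2 i.exists_adj.choose_spec⟩

lemma arguments_unpaired (γ : FeynmanDiagram n) (z : γ.Unpaired → M) (w : γ.Edge → M)
    (i : γ.Unpaired) : γ.arguments z w i = z i :=
  dif_neg (not_exists.2 i.2)

lemma arguments_paired (γ : FeynmanDiagram n) (z : γ.Unpaired → M) (w : γ.Edge → M)
    (i : γ.Paired) : γ.arguments z w i = w (γ.edgeAt i) :=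
  dif_pos i.exists_adj

lemma edgeAt_eq_iff (γ : FeynmanDiagram n) (i : γ.Paired) (e : γ.Edge) :
    γ.edgeAt i = e ↔ i.1 ∈ e.1 := by
  constructor
  · rintro rfl
    exact Sym2.mem_mk_left _ _
  · intro hi
    obtain ⟨j, hj⟩ := Sym2.mem_iff_exists.1 hi
    have hadj : γ.graph.Adj i.1 j := by
      rw [← SimpleGraph.mem_edgeSet, ← hj]; exact e.2
    refine Subtype.ext ?_
    rw [hj]
    change s(i.1, i.exists_adj.choose) = s(i.1, j)
    rw [γ.matching _ _ _ i.exists_adj.choose_spec hadj]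

open Classical in
/-- In a product over the vertices, the variable of an unpaired vertex occurs once and the variable
of an edge twice. -/
lemma prod_arguments (γ : FeynmanDiagram n) (z : γ.Unpaired → M) (w : γ.Edge → M) (h : M → ℝ) :
    ∏ i, h (γ.arguments z w i) = (∏ a, h (z a)) * ∏ e, h (w e) ^ 2 := by
  rw [← Fintype.prod_subtype_mul_prod_subtype (fun i => ∀ j, ¬ γ.graph.Adj i j)
    fun i => h (γ.arguments z w i)]
  congr 1
  · refine (Finset.prod_congr rfl fun i _ =>
      congrArg h (γ.arguments_unpaired z w i)).trans ?_
    congr!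
  · have h1 : ∀ i : γ.Paired, h (γ.arguments z w i) = h (w (γ.edgeAt i)) := fun i => by
      rw [γ.arguments_paired]
    rw [Finset.prod_congr rfl fun i _ => h1 i, ← Finset.prod_fiberwise Finset.univ γ.edgeAt]
    refine Finset.prod_congr rfl fun e _ => ?_
    rw [Finset.prod_congr rfl fun i hi => by rw [(Finset.mem_filter.1 hi).2], Finset.prod_const]
    congr 1
    obtain ⟨⟨a, b⟩, hab⟩ := e
    have hadj : γ.graph.Adj a b := hab
    have ha : ¬ ∀ j, ¬ γ.graph.Adj a j := fun hn => hn b hadj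
    have hb : ¬ ∀ j, ¬ γ.graph.Adj b j := fun hn => hn a hadj.symm
    -- The vertices at an edge are its two endpoints.
    have hset : Finset.univ.filter (fun i => γ.edgeAt i = ⟨s(a, b), hab⟩)
        = {(⟨a, ha⟩ : γ.Paired), ⟨b, hb⟩} := by
      ext i
      rw [Finset.mem_filter, γ.edgeAt_eq_iff]
      simp [Subtype.ext_iff]
    exact (congrArg Finset.card hset).trans
      (Finset.card_pair fun hne => hadj.ne (congrArg Subtype.val hne))

lemma measurable_arguments [MeasurableSpace M] (γ : FeynmanDiagram n) :
    Measurable fun p : (γ.Unpaired → M) × (γ.Edge → M) => γ.arguments p.1 p.2 := by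
  refine measurable_pi_iff.2 fun i => ?_
  by_cases hi : ∀ j, ¬ γ.graph.Adj i j
  · have := fun p : (γ.Unpaired → M) × (γ.Edge → M) => γ.arguments_unpaired p.1 p.2 ⟨i, hi⟩
    simp only at this
    simp_rw [this]
    fun_prop
  · have := fun p : (γ.Unpaired → M) × (γ.Edge → M) => γ.arguments_paired p.1 p.2 ⟨i, hi⟩
    simp only at this
    simp_rw [this]
    fun_prop

lemma arguments_prop (γ : FeynmanDiagram n) {z : γ.Unpaired → M} {w : γ.Edge → M} {p : M → Prop}
    (hz : ∀ a, p (z a)) (hw : ∀ e, p (w e)) (i : Fin n) : p (γ.arguments z w i) := by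
  by_cases hi : ∀ j, ¬ γ.graph.Adj i j
  · rw [γ.arguments_unpaired z w ⟨i, hi⟩]; exact hz _
  · rw [γ.arguments_paired z w ⟨i, hi⟩]; exact hw _

end FeynmanDiagram

section Intensities

variable {d : ℕ} {μ σ lam p : ℝ}

instance : SigmaFinite (ouInvariant d μ σ) := by unfold ouInvariant; infer_instance

instance : SigmaFinite (branchTime lam p) := by unfold branchTime; infer_instance

instance : SigmaFinite (intensityOne d μ σ lam p) := by unfold intensityOne; infer_instance

instance : SigmaFinite (intensityTwo d μ σ lam p) := by unfold intensityTwo; infer_instance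

lemma nullSingletonClass_intensityOne (hd : 1 ≤ d) :
    NullSingletonClass (intensityOne d μ σ lam p) := by
  have : Nonempty (Fin d) := ⟨⟨0, hd⟩⟩
  have : NullSingletonClass (ouInvariant d μ σ) := by unfold ouInvariant; infer_instance
  unfold intensityOne; infer_instance

lemma ae_branchTime_nonneg : ∀ᵐ s ∂(branchTime lam p), 0 ≤ s :=
  (withDensity_absolutelyContinuous _ _).ae_le (ae_restrict_mem measurableSet_Ici)

lemma ae_intensityTwo_nonneg : ∀ᵐ q ∂(intensityTwo d μ σ lam p), 0 ≤ q.1 :=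
  Measure.quasiMeasurePreserving_fst.ae ae_branchTime_nonneg

lemma ae_intensityOne_nonneg : ∀ᵐ q ∂(intensityOne d μ σ lam p), 0 ≤ q.1 := by
  refine Measure.quasiMeasurePreserving_fst.ae (p := fun s : ℝ => 0 ≤ s) ?_
  rw [ae_add_measure_iff]
  exact ⟨by simp [ae_dirac_eq], ae_branchTime_nonneg⟩

/-- The decay `e^{-2μs}` of a pair of particles beats the growth `e^{λ_p s}`. -/
lemma integrable_exp_branchTime (hlam : 0 < lam) (hp : 0 < p) (hslow : growthRate lam p < 2 * μ) :
    Integrable (fun s => Real.exp (-2 * μ * s)) (branchTime lam p) := by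
  unfold branchTime
  rw [integrable_withDensity_iff_integrable_smul' (by fun_prop) (by simp)]
  have h : IntegrableOn (fun s => Real.exp ((growthRate lam p - 2 * μ) * s)) (Set.Ici 0) := by
    rw [integrableOn_Ici_iff_integrableOn_Ioi]
    exact integrableOn_exp_mul_Ioi (by linarith) 0
  refine (h.const_mul (2 * lam * p)).congr (Eventually.of_forall fun s => ?_)
  simp only
  rw [ENNReal.toReal_ofReal (by positivity), smul_eq_mul, mul_assoc (2 * lam * p), ← Real.exp_add]
  ring_nf

lemma siteBound_sq (q : TimeSpace d) :
    siteBound μ σ q ^ 2 = decayConst d μ σ ^ 2 * (Real.exp (-2 * μ * q.1) * expWeight 6 q.2) := by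
  have h1 : Real.exp (-2 * μ * q.1) = Real.exp (-μ * q.1) * Real.exp (-μ * q.1) := by
    rw [← Real.exp_add]; ring_nf
  have h2 : expWeight 6 q.2 = expWeight 3 q.2 * expWeight 3 q.2 := by
    rw [expWeight_mul]; norm_num
  rw [siteBound, h1, h2]; ring

lemma integrable_siteBound_sq_intensityTwo (hμ : 0 < μ) (hσ : 0 < σ) (hlam : 0 < lam) (hp : 0 < p)
    (hslow : growthRate lam p < 2 * μ) :
    Integrable (fun q => siteBound μ σ q ^ 2) (intensityTwo d μ σ lam p) := by
  simp_rw [siteBound_sq]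
  exact ((integrable_exp_branchTime hlam hp hslow).mul_prod
    (integrable_expWeight hμ hσ (by norm_num))).const_mul _

lemma integrable_siteBound_sq_intensityOne (hμ : 0 < μ) (hσ : 0 < σ) (hlam : 0 < lam) (hp : 0 < p)
    (hslow : growthRate lam p < 2 * μ) :
    Integrable (fun q => siteBound μ σ q ^ 2) (intensityOne d μ σ lam p) := by
  simp_rw [siteBound_sq]
  have h : Integrable (fun s => Real.exp (-2 * μ * s)) (Measure.dirac 0 + branchTime lam p) :=
    (integrable_dirac (by simp)).add_measure (integrable_exp_branchTime hlam hp hslow)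
  exact (h.mul_prod (integrable_expWeight hμ hσ (by norm_num))).const_mul _

end Intensities

section DiagramKernel

variable {n d : ℕ} {μ σ lam p : ℝ}

lemma ae_pi_nonneg {ι : Type*} [Fintype ι] {ν : Measure (TimeSpace d)} [SigmaFinite ν]
    (h : ∀ᵐ q ∂ν, 0 ≤ q.1) : ∀ᵐ z ∂(Measure.pi fun _ : ι => ν), ∀ i, 0 ≤ (z i).1 :=
  eventually_all.2 fun i => (Measure.quasiMeasurePreserving_eval (fun _ => ν) i).ae h

lemma abs_ouTensor_arguments_le (hμ : 0 < μ) (hσ : 0 < σ) {f : PSpace n d}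
    (hf : IsCanonical μ σ f.toFun) (γ : FeynmanDiagram n) {z : γ.Unpaired → TimeSpace d}
    {w : γ.Edge → TimeSpace d} (hz : ∀ a, 0 ≤ (z a).1) (hw : ∀ e, 0 ≤ (w e).1) :
    |ouTensor μ σ f.toFun (γ.arguments z w)|
      ≤ ‖f‖ * (∏ a, siteBound μ σ (z a)) * ∏ e, siteBound μ σ (w e) ^ 2 := by
  refine (abs_ouTensor_le hμ hσ f.continuous_toFun f.abs_toFun_le hf
    (γ.arguments_prop (p := fun q : TimeSpace d => 0 ≤ q.1) hz hw)).trans_eq ?_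
  rw [γ.prod_arguments, mul_assoc]

lemma integrable_prod_siteBound_sq (hμ : 0 < μ) (hσ : 0 < σ) (hlam : 0 < lam) (hp : 0 < p)
    (hslow : growthRate lam p < 2 * μ) (ι : Type*) [Fintype ι] :
    Integrable (fun w : ι → TimeSpace d => ∏ e, siteBound μ σ (w e) ^ 2)
      (Measure.pi fun _ => intensityTwo d μ σ lam p) :=
  Integrable.fintype_prod (f := fun _ q => siteBound μ σ q ^ 2)
    fun _ => integrable_siteBound_sq_intensityTwo hμ hσ hlam hp hslow

/-- The integrals over the edges converge absolutely. -/
lemma integrable_ouTensor_arguments (hμ : 0 < μ) (hσ : 0 < σ) (hlam : 0 < lam) (hp : 0 < p)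
    (hslow : growthRate lam p < 2 * μ) {f : PSpace n d} (hf : IsCanonical μ σ f.toFun)
    (γ : FeynmanDiagram n) {z : γ.Unpaired → TimeSpace d} (hz : ∀ a, 0 ≤ (z a).1) :
    Integrable (fun w => ouTensor μ σ f.toFun (γ.arguments z w))
      (Measure.pi fun _ : γ.Edge => intensityTwo d μ σ lam p) := by
  refine ((integrable_prod_siteBound_sq hμ hσ hlam hp hslow γ.Edge).const_mul
    (‖f‖ * ∏ a, siteBound μ σ (z a))).mono' ?_ ?_
  · exact ((stronglyMeasurable_ouTensor hμ hσ f.continuous_toFun).comp_measurable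
      (γ.measurable_arguments.comp (measurable_const.prodMk measurable_id))).aestronglyMeasurable
  · filter_upwards [ae_pi_nonneg ae_intensityTwo_nonneg] with w hw
    exact abs_ouTensor_arguments_le hμ hσ hf γ hz hw

/-- The function that dominates the kernels of the diagram `γ`, for `‖f‖ ≤ 1`. -/
noncomputable def kernelBound (μ σ lam p : ℝ) (γ : FeynmanDiagram n)
    (z : γ.Unpaired → TimeSpace d) : ℝ :=
  (∏ a, siteBound μ σ (z a)) * ∫ w : γ.Edge → TimeSpace d, ∏ e, siteBound μ σ (w e) ^ 2
    ∂(Measure.pi fun _ => intensityTwo d μ σ lam p)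

lemma memLp_kernelBound (hμ : 0 < μ) (hσ : 0 < σ) (hlam : 0 < lam) (hp : 0 < p)
    (hslow : growthRate lam p < 2 * μ) (γ : FeynmanDiagram n) :
    MemLp (kernelBound (d := d) μ σ lam p γ) 2
      (Measure.pi fun _ => intensityOne d μ σ lam p) := by
  have h : MemLp (fun z : γ.Unpaired → TimeSpace d => ∏ a, siteBound μ σ (z a)) 2
      (Measure.pi fun _ => intensityOne d μ σ lam p) := by
    rw [memLp_two_iff_integrable_sq]
    · simp_rw [← Finset.prod_pow]
      exact Integrable.fintype_prod (f := fun _ q => siteBound μ σ q ^ 2)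
        fun _ => integrable_siteBound_sq_intensityOne hμ hσ hlam hp hslow
    · refine Continuous.aestronglyMeasurable ?_
      have := continuous_siteBound (d := d) (μ := μ) (σ := σ)
      fun_prop
  exact h.mul_const _

lemma abs_diagramKernel_le (hμ : 0 < μ) (hσ : 0 < σ) (hlam : 0 < lam) (hp : 0 < p)
    (hslow : growthRate lam p < 2 * μ) {f : PSpace n d} (hf : IsCanonical μ σ f.toFun)
    (γ : FeynmanDiagram n) {z : γ.Unpaired → TimeSpace d} (hz : ∀ a, 0 ≤ (z a).1) :
    |diagramKernel μ σ lam p f.toFun γ z| ≤ ‖f‖ * kernelBound μ σ lam p γ z := by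
  have h := norm_integral_le_of_norm_le
    (f := fun w => ouTensor μ σ f.toFun (γ.arguments z w))
    ((integrable_prod_siteBound_sq hμ hσ hlam hp hslow γ.Edge).const_mul
    (‖f‖ * ∏ a, siteBound μ σ (z a)))
    ((ae_pi_nonneg ae_intensityTwo_nonneg).mono fun w hw =>
      abs_ouTensor_arguments_le hμ hσ hf γ hz hw)
  refine h.trans_eq ?_
  rw [integral_const_mul, kernelBound, mul_assoc]

lemma memLp_diagramKernel (hμ : 0 < μ) (hσ : 0 < σ) (hlam : 0 < lam) (hp : 0 < p)
    (hslow : growthRate lam p < 2 * μ) {f : PSpace n d} (hf : IsCanonical μ σ f.toFun)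
    (γ : FeynmanDiagram n) :
    MemLp (diagramKernel μ σ lam p f.toFun γ) 2
      (Measure.pi fun _ => intensityOne d μ σ lam p) := by
  refine ((memLp_kernelBound hμ hσ hlam hp hslow γ).const_mul ‖f‖).mono' ?_ ?_
  · have h : StronglyMeasurable (Function.uncurry fun (z : γ.Unpaired → TimeSpace d)
        (w : γ.Edge → TimeSpace d) => ouTensor μ σ f.toFun (γ.arguments z w)) :=
      (stronglyMeasurable_ouTensor hμ hσ f.continuous_toFun).comp_measurable γ.measurable_arguments
    exact h.integral_prod_right.aestronglyMeasurable
  · filter_upwards [ae_pi_nonneg ae_intensityOne_nonneg] with z hz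
    exact abs_diagramKernel_le hμ hσ hlam hp hslow hf γ hz

lemma eLpNorm_diagramKernel_sub_le (hμ : 0 < μ) (hσ : 0 < σ) (hlam : 0 < lam) (hp : 0 < p)
    (hslow : growthRate lam p < 2 * μ) {f g : PSpace n d} (hf : IsCanonical μ σ f.toFun)
    (hg : IsCanonical μ σ g.toFun) (γ : FeynmanDiagram n) :
    eLpNorm (fun z => diagramKernel μ σ lam p f.toFun γ z - diagramKernel μ σ lam p g.toFun γ z) 2
        (Measure.pi fun _ => intensityOne d μ σ lam p)
      ≤ ENNReal.ofReal ‖f - g‖ * eLpNorm (kernelBound (d := d) μ σ lam p γ) 2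
        (Measure.pi fun _ => intensityOne d μ σ lam p) := by
  refine eLpNorm_le_mul_eLpNorm_of_ae_le_mul ?_ 2
  filter_upwards [ae_pi_nonneg ae_intensityOne_nonneg] with z hz
  have hsub : diagramKernel μ σ lam p (f - g).toFun γ z
      = diagramKernel μ σ lam p f.toFun γ z - diagramKernel μ σ lam p g.toFun γ z := by
    unfold diagramKernel
    rw [← integral_sub (integrable_ouTensor_arguments hμ hσ hlam hp hslow hf γ hz)
      (integrable_ouTensor_arguments hμ hσ hlam hp hslow hg γ hz)]
    refine integral_congr_ae ?_
    filter_upwards [ae_pi_nonneg ae_intensityTwo_nonneg] with w hw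
    exact ouTensor_sub hμ hσ f g
      (γ.arguments_prop (p := fun q : TimeSpace d => 0 ≤ q.1) hz hw)
  rw [← hsub]
  exact (abs_diagramKernel_le hμ hσ hlam hp hslow (isCanonical_sub hμ hσ hf hg) γ hz).trans
    (mul_le_mul_of_nonneg_left (le_abs_self _) (norm_nonneg _))

end DiagramKernel

/-! ### Well-definedness and continuity of the limit variable -/

/-- For `Z` a Gaussian stochastic measure with intensity `μ₁`: every `L(f, γ)` is well defined (the
integrals over the edges converge absolutely, and the multiple stochastic integral of the resulting
kernel exists and is almost surely unique), `L₁(f)` has a finite second moment, and `L₁` is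
continuous from the canonical kernels into `L²`. -/
theorem mainTheorem6 {n d : ℕ} (hn : 1 ≤ n) (hd : 1 ≤ d) {μ σ lam p : ℝ}
    (hμ : 0 < μ) (hσ : 0 < σ) (hlam : 0 < lam) (hp : 1 / 2 < p) (hp1 : p ≤ 1)
    (hslow : growthRate lam p < 2 * μ)
    {Ω : Type*} [MeasurableSpace Ω] (P : Measure Ω) [IsProbabilityMeasure P]
    (Z : Set (TimeSpace d) → Ω → ℝ)
    (hZ : IsGaussianStochasticMeasure (intensityOne d μ σ lam p) P Z) :
    (∀ f ∈ Can n d μ σ, ∀ γ : FeynmanDiagram n,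
      (∀ z : γ.Unpaired → TimeSpace d, (∀ i, 0 ≤ (z i).1) →
        Integrable (fun w => ouTensor μ σ f.toFun (γ.arguments z w))
          (Measure.pi fun _ : γ.Edge => intensityTwo d μ σ lam p)) ∧
      ∀ X : Ω → ℝ,
        HasMultipleIntegral (intensityOne d μ σ lam p) P Z
            (diagramKernel μ σ lam p f.toFun γ) X ↔
          X =ᵐ[P] diagramVariable μ σ lam p P Z f.toFun γ) ∧
    ∃ hL : ∀ f : Can n d μ σ, MemLp (limitVariable μ σ lam p P Z f.1.toFun) 2 P,
      Continuous fun f : Can n d μ σ => (hL f).toLp (limitVariable μ σ lam p P Z f.1.toFun) := by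
  have hp0 : 0 < p := by linarith
  have := nullSingletonClass_intensityOne (d := d) (μ := μ) (σ := σ) (lam := lam) (p := p) hd
  have hiff : ∀ f ∈ Can n d μ σ, ∀ (γ : FeynmanDiagram n) (X : Ω → ℝ),
      HasMultipleIntegral (intensityOne d μ σ lam p) P Z (diagramKernel μ σ lam p f.toFun γ) X ↔
        X =ᵐ[P] diagramVariable μ σ lam p P Z f.toFun γ := fun f hf γ X =>
    hasMultipleIntegral_iff hZ (memLp_diagramKernel hμ hσ hlam hp0 hslow hf γ) X
  have hI : ∀ f ∈ Can n d μ σ, ∀ γ : FeynmanDiagram n,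
      HasMultipleIntegral (intensityOne d μ σ lam p) P Z (diagramKernel μ σ lam p f.toFun γ)
        (diagramVariable μ σ lam p P Z f.toFun γ) := fun f hf γ =>
    (hiff f hf γ _).2 EventuallyEq.rfl
  have hL : ∀ f : Can n d μ σ, MemLp (limitVariable μ σ lam p P Z f.1.toFun) 2 P := fun f =>
    memLp_finsetSum _ fun γ _ => (hI f.1 f.2 γ).2.1
  refine ⟨fun f hf γ => ⟨fun z hz =>
    integrable_ouTensor_arguments hμ hσ hlam hp0 hslow hf γ hz, hiff f hf γ⟩, hL, ?_⟩
  let B : ENNReal := ∑ γ : FeynmanDiagram n, ElementaryIntegrand.integralBound γ.Unpaired *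
    eLpNorm (kernelBound (d := d) μ σ lam p γ) 2 (Measure.pi fun _ => intensityOne d μ σ lam p)
  have hB : B ≠ ⊤ := ENNReal.sum_ne_top.2 fun γ _ =>
    ENNReal.mul_ne_top ENNReal.ofReal_ne_top (memLp_kernelBound hμ hσ hlam hp0 hslow γ).2.ne
  have hlip : ∀ f g : Can n d μ σ, eLpNorm (limitVariable μ σ lam p P Z f.1.toFun
      - limitVariable μ σ lam p P Z g.1.toFun) 2 P ≤ ENNReal.ofReal ‖f.1 - g.1‖ * B := by
    intro f g
    have h1 : limitVariable μ σ lam p P Z f.1.toFun - limitVariable μ σ lam p P Z g.1.toFun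
        = ∑ γ : FeynmanDiagram n, fun ω => diagramVariable μ σ lam p P Z f.1.toFun γ ω
          - diagramVariable μ σ lam p P Z g.1.toFun γ ω := by
      ext ω
      simp [limitVariable, Finset.sum_apply, Finset.sum_sub_distrib]
    rw [h1, Finset.mul_sum]
    refine (eLpNorm_sum_le (fun γ _ => (hI f.1 f.2 γ).2.1.1.sub (hI g.1 g.2 γ).2.1.1)
      (by simp)).trans (Finset.sum_le_sum fun γ _ => ?_)
    refine ((hI f.1 f.2 γ).eLpNorm_sub_le hZ (hI g.1 g.2 γ)).trans ?_
    rw [mul_left_comm]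
    exact mul_le_mul_right (eLpNorm_diagramKernel_sub_le hμ hσ hlam hp0 hslow f.2 g.2 γ) _
  refine (LipschitzWith.of_dist_le_mul (K := B.toNNReal) fun f g => ?_).continuous
  rw [dist_eq_norm, ← MemLp.toLp_sub, Lp.norm_toLp]
  refine (ENNReal.toReal_mono (ENNReal.mul_ne_top ENNReal.ofReal_ne_top hB) (hlip f g)).trans_eq ?_
  rw [ENNReal.toReal_mul, ENNReal.toReal_ofReal (norm_nonneg _), mul_comm, Subtype.dist_eq,
    dist_eq_norm]
  rfl
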